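/- Let $d\ge 2$ and let $f(z)=\prod_{j=1}^d (z-\zeta_j)$ be a complex polynomial with distinct roots $\zeta_j$ satisfying $|\zeta_j|<1$. For a root $\zeta$ of $f$, let $\operatorname{Basin}(\zeta)$ be the set of all $z\in\mathbb C$ such that the solution of $\dot\varphi=-f(\varphi)\,\overline{f'(\varphi)}$, $\varphi(0)=z$ (the Newton flow $\dot z=-f(z)/f'(z)$ rescaled by $|f'|^2$), exists for all $t\ge 0$ and converges to $\zeta$ as $t\to\infty$. Put $$\rho_\zeta=\min\{|f(c)| : f'(c)=0,\ c\in\overline{\operatorname{Basin}(\zeta)}\}.$$ This minimum exists, and $\rho_\zeta$ is the radius of convergence of the power series at $0$ of the branch of $f^{-1}$ taking $0$ to $\zeta$. For every $r>1$ there is a number $s_r\in(0,1)$, depending only on $r$ and $d$, such that for every such $f$, every root $\zeta$ of $f$, and every $z\in\operatorname{Basin}(\zeta)$ with $|z|=r$, $$|f(z)|\ge s_r\,\rho_\zeta .$$ Here $s_r=\tfrac14$ if $r>1+\tfrac{2\pi}{d}$; otherwise, writing $r=1+\tfrac{C}{d}$ (so $0<C\le 2\pi$), $s_r$ is the smallest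 positive solution $s$ of $$C=8\pi\frac{s}{(1-s)^2}.$$ In particular, for $C=1$ one has $s_r>\tfrac1{28}$. -/

import Mathlib

open Polynomial Topology Filter

noncomputable section

namespace NewtonFlow

/-- The class of monic complex polynomials `∏ (X - ζ_j)` of degree `d` with distinct roots
`ζ_1, …, ζ_d` in the open unit disk. -/
def MemPd (d : ℕ) (f : ℂ[X]) : Prop :=
  ∃ ζ : Fin d → ℂ, Function.Injective ζ ∧ (∀ j, ‖ζ j‖ < 1) ∧ f = ∏ j, (X - C (ζ j))

/-- The Newton field `-f/f'` rescaled by `|f'|²`, that is `-f · conj f'`; up to a constant positive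
change of time this is the gradient field `-∇|f|²`. -/
def rescaledField (f : ℂ[X]) (z : ℂ) : ℂ :=
  -(f.eval z * (starRingEnd ℂ) ((derivative f).eval z))

/-- The basin of attraction of `ζ`: all points whose forward orbit under the (rescaled) Newton flow
converges to `ζ`. -/
def basin (f : ℂ[X]) (ζ : ℂ) : Set ℂ :=
  {z | ∃ φ : ℝ → ℂ, φ 0 = z ∧
    (∀ t : ℝ, 0 ≤ t → HasDerivWithinAt φ (rescaledField f (φ t)) (Set.Ici 0) t) ∧
    Tendsto φ atTop (𝓝 ζ)}

/-- The critical points of `f` in the closure of the basin of `ζ`. -/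
def criticalPoints (f : ℂ[X]) (ζ : ℂ) : Set ℂ :=
  {c | (derivative f).eval c = 0} ∩ closure (basin f ζ)

/-- The moduli of the critical values belonging to `ζ`. -/
def criticalModuli (f : ℂ[X]) (ζ : ℂ) : Set ℝ :=
  (fun c => ‖f.eval c‖) '' criticalPoints f ζ

/-- The smallest modulus of a critical value belonging to `ζ`. The infimum is used only where it is
a minimum (which the theorem asserts). -/
def rho (f : ℂ[X]) (ζ : ℂ) : ℝ := sInf (criticalModuli f ζ)

/-- `p` is the power series at `0` of the local branch of `f⁻¹` taking `0` to `ζ`. -/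
def IsInverseBranchSeries (f : ℂ[X]) (ζ : ℂ) (p : FormalMultilinearSeries ℂ ℂ ℂ) : Prop :=
  ∃ g : ℂ → ℂ, HasFPowerSeriesAt g p 0 ∧ g 0 = ζ ∧ ∀ᶠ w in 𝓝 (0 : ℂ), f.eval (g w) = w

end NewtonFlow

end

open MeasureTheory Set Complex Metric
open scoped ENNReal

/-! Let `g` be the branch of `f⁻¹` with `g 0 = ζ`, and `R` its radius of convergence. The Newton
flow moves values of `f` radially to `0`, so `g` maps the disk of radius `R` onto the part of the
basin where `|f| < R`. Boundedness of that image and compactness of the closed disk allow `g` to be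
continued past radius `R` unless a critical point lies in the closure of the image; hence `R = ρ`.
It remains to bound from below those `t < R` for which the preimage `g (t e)` of a ray has modulus
`r`.

The geometric input is `Re (z f'/f) > d |z| / (|z| + 1)` for `|z| ≥ 1`, summed from the single
factors `z / (z - ζ_j)`. On an arc of the unit circle of angle `4π/d` the argument of `f` therefore
gains more than `2π`, so two of its points have values on a common ray. As the modulus strictly
increases along preimages of rays outside the unit disk, `g` cannot cover both. Thus the image of
`g` contains no disk of radius above `2π/d` centred on the unit circle (`radius_le_of_ball_subset`).
Where the preimage of the ray crosses the unit circle, `g` omits a value at distance arbitrarily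
close to `2π/d` or less, and the Koebe growth theorem for univalent functions omitting a value gives
`|g (t e)| - 1 ≤ (8π/d) k(t/R)` with `k(x) = x / (1 - x)^2` (`norm_ray_sub_one_le`).

For `r ≤ 1 + 2π/d` this is the claim. For larger `r` it yields only `3 - 2√2 < 1/4`; there it is
used up to `t = R/16` and combined with a differential inequality for `|g|` along the ray, while
degrees below `5` follow from `|f(z)| ≥ (|z| - 1)^d` (`quarter_le_norm`).

The Koebe theorems are derived from a comparison of logarithmic areas, that is, areas for the
density `1/|w|^2`. -/

/-! ### Logarithmic area in annuli -/

/-- Change of variables for an injective holomorphic map. -/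
theorem lintegral_image_eq_lintegral_normSq_deriv_mul {s : Set ℂ} (hs : MeasurableSet s)
    {f f' : ℂ → ℂ} (hf' : ∀ z ∈ s, HasDerivAt f (f' z) z) (hf : InjOn f s) (g : ℂ → ℝ≥0∞) :
    ∫⁻ w in f '' s, g w = ∫⁻ z in s, ENNReal.ofReal (‖f' z‖ ^ 2) * g (f z) := by
  have h := lintegral_image_eq_lintegral_abs_det_fderiv_mul volume hs
    (f' := fun z => (ContinuousLinearMap.toSpanSingleton ℂ (f' z)).restrictScalars ℝ)
    (fun z hz => ((hf' z hz).hasFDerivAt.restrictScalars ℝ).hasFDerivWithinAt) hf g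
  rw [h]
  congr! 4 with z
  simp [ContinuousLinearMap.det, LinearMap.det_restrictScalars,
      Algebra.norm_complex_eq, Complex.normSq_eq_norm_sq]

/-- The open annulus around `0`. -/
def openAnnulus (a b : ℝ) : Set ℂ := {z | a < ‖z‖ ∧ ‖z‖ < b}

theorem isOpen_openAnnulus (a b : ℝ) : IsOpen (openAnnulus a b) :=
  (isOpen_lt continuous_const continuous_norm).inter (isOpen_lt continuous_norm continuous_const)

theorem lintegral_Ioo_inv {a b : ℝ} (ha : 0 < a) (hab : a ≤ b) :
    ∫⁻ x in Ioo a b, ENNReal.ofReal (1 / x) = ENNReal.ofReal (Real.log (b / a)) := by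
  rw [← integral_one_div_of_pos ha (ha.trans_le hab), intervalIntegral.integral_of_le hab,
    ← integral_Ioc_eq_integral_Ioo.symm, ofReal_integral_eq_lintegral_ofReal]
  · have : IntervalIntegrable (fun x : ℝ => 1 / x) volume a b :=
      intervalIntegral.intervalIntegrable_one_div (fun x hx => by
        rw [uIcc_of_le hab] at hx; exact (ha.trans_le hx.1).ne') continuousOn_id
    exact (intervalIntegrable_iff_integrableOn_Ioo_of_le hab).1 this
  · filter_upwards [self_mem_ae_restrict measurableSet_Ioo] with x hx
    have := ha.trans hx.1
    simp only [Pi.zero_apply]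
    positivity

theorem lintegral_openAnnulus_eq {a b : ℝ} (ha : 0 < a) {u : ℂ → ℝ≥0∞}
    (hu : ContinuousOn u (openAnnulus a b)) :
    ∫⁻ z in openAnnulus a b, u z =
      ∫⁻ ρ in Ioo a b, ENNReal.ofReal ρ *
        ∫⁻ θ in Ioo (-Real.pi) Real.pi, u (circleMap 0 ρ θ) := by
  have hm := (isOpen_openAnnulus a b).measurableSet
  have hind : ∀ p ∈ polarCoord.target,
      ENNReal.ofReal p.1 • (openAnnulus a b).indicator u (Complex.polarCoord.symm p) =
      (Ioo a b ×ˢ Ioo (-Real.pi) Real.pi).indicator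
        (fun p => ENNReal.ofReal p.1 * u (circleMap 0 p.1 p.2)) p := by
    intro p hp
    have hp1 : 0 < p.1 := hp.1
    have e : Complex.polarCoord.symm p = circleMap 0 p.1 p.2 := by
      simp [circleMap, Complex.exp_mul_I]
    have hn : ‖Complex.polarCoord.symm p‖ = p.1 := by
      rw [Complex.norm_polarCoord_symm, abs_of_pos hp1]
    by_cases h : p.1 ∈ Ioo a b
    · have h' : p ∈ Ioo a b ×ˢ Ioo (-Real.pi) Real.pi := ⟨h, hp.2⟩
      rw [indicator_of_mem (by simp only [openAnnulus, mem_ofPred_eq, hn]; exact h),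
        indicator_of_mem h', e, smul_eq_mul]
    · rw [indicator_of_notMem (by simp only [openAnnulus, mem_ofPred_eq, hn]; exact h),
        indicator_of_notMem (fun h' => h h'.1), smul_zero]
  have hsub : Ioo a b ×ˢ Ioo (-Real.pi) Real.pi ⊆ polarCoord.target := fun p hp =>
    ⟨ha.trans hp.1.1, hp.2⟩
  have hms : MeasurableSet (Ioo a b ×ˢ Ioo (-Real.pi) Real.pi) :=
    measurableSet_Ioo.prod measurableSet_Ioo
  have hcm : Continuous fun p : ℝ × ℝ => circleMap 0 p.1 p.2 := by
    unfold circleMap; fun_prop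
  rw [← lintegral_indicator hm, ← Complex.lintegral_comp_polarCoord_symm,
    setLIntegral_congr_fun polarCoord.open_target.measurableSet hind,
    setLIntegral_indicator hms, inter_eq_left.2 hsub, Measure.volume_eq_prod,
    setLIntegral_prod]
  · refine lintegral_congr fun ρ => ?_
    exact lintegral_const_mul' _ _ ENNReal.ofReal_ne_top
  · refine AEMeasurable.mul (by fun_prop) ?_
    refine (ContinuousOn.comp hu hcm.continuousOn ?_).aemeasurable hms
    intro p hp
    have : 0 < p.1 := ha.trans hp.1.1
    simpa [openAnnulus, abs_of_pos this] using hp.1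

theorem lintegral_openAnnulus_one_div_sq {a b : ℝ} (ha : 0 < a) (hab : a ≤ b) :
    ∫⁻ z in openAnnulus a b, ENNReal.ofReal (1 / ‖z‖ ^ 2) =
      ENNReal.ofReal (2 * Real.pi * Real.log (b / a)) := by
  rw [lintegral_openAnnulus_eq ha, ENNReal.ofReal_mul (by positivity), ← lintegral_Ioo_inv ha hab,
    ← lintegral_const_mul' _ _ ENNReal.ofReal_ne_top]
  · refine setLIntegral_congr_fun measurableSet_Ioo fun ρ hρ => ?_
    have h0 : 0 < ρ := ha.trans hρ.1
    simp only [norm_circleMap_zero, sq_abs, lintegral_const, MeasurableSet.univ,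
      Measure.restrict_apply, univ_inter, Real.volume_Ioo]
    rw [← ENNReal.ofReal_mul (by positivity), ← ENNReal.ofReal_mul (by positivity),
      ← ENNReal.ofReal_mul (by positivity)]
    congr 1
    field_simp
    ring
  · refine ENNReal.continuous_ofReal.comp_continuousOn ?_
    refine continuousOn_const.div (by fun_prop) fun z hz => ?_
    have := ha.trans hz.1
    positivity

theorem le_lintegral_circle {H : ℂ → ℂ} {R ρ : ℝ} (hH : DifferentiableOn ℂ H (ball 0 R))
    (hρ : 0 < ρ) (hρR : ρ < R) :
    ENNReal.ofReal (2 * Real.pi * ‖H 0‖) ≤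
      ∫⁻ θ in Ioo (-Real.pi) Real.pi, ENNReal.ofReal ‖H (circleMap 0 ρ θ)‖ := by
  have hd : DiffContOnCl ℂ H (ball 0 |ρ|) := by
    refine DifferentiableOn.diffContOnCl ?_
    rw [closure_ball _ (abs_pos.2 hρ.ne').ne', abs_of_pos hρ]
    exact hH.mono (closedBall_subset_ball hρR)
  have h := hd.circleAverage
  rw [Real.circleAverage_eq_integral_add (-Real.pi)] at h
  have h2 : ∫ θ in (-Real.pi)..Real.pi, H (circleMap 0 ρ θ) = (2 * Real.pi : ℝ) • H 0 := by
    rw [← h, smul_smul, mul_inv_cancel₀ (by positivity), one_smul,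
      intervalIntegral.integral_comp_add_right (fun θ => H (circleMap 0 ρ θ))]
    congr 1 <;> ring
  rw [intervalIntegral.integral_of_le (by linarith [Real.pi_pos]),
    integral_Ioc_eq_integral_Ioo] at h2
  have h3 := enorm_integral_le_lintegral_enorm
    (μ := volume.restrict (Ioo (-Real.pi) Real.pi)) (fun θ => H (circleMap 0 ρ θ))
  rw [h2] at h3
  simp only [← ofReal_norm, norm_smul, Real.norm_eq_abs] at h3
  rwa [abs_of_pos (by positivity)] at h3

/-- The mean value property bounds the integral over each circle; integrating over the radius gives
the logarithm. Applied to `H = (z T'/T)^2`, this bounds the logarithmic area of the image of an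
annulus under `T` from below. -/
theorem le_lintegral_openAnnulus {H : ℂ → ℂ} {R a b : ℝ} (hH : DifferentiableOn ℂ H (ball 0 R))
    (ha : 0 < a) (hab : a ≤ b) (hbR : b ≤ R) :
    ENNReal.ofReal (2 * Real.pi * ‖H 0‖ * Real.log (b / a)) ≤
      ∫⁻ z in openAnnulus a b, ENNReal.ofReal (‖H z‖ / ‖z‖ ^ 2) := by
  rw [lintegral_openAnnulus_eq ha, ENNReal.ofReal_mul (by positivity), ← lintegral_Ioo_inv ha hab,
    ← lintegral_const_mul' _ _ ENNReal.ofReal_ne_top]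
  · refine setLIntegral_mono' measurableSet_Ioo fun ρ hρ => ?_
    have h0 : 0 < ρ := ha.trans hρ.1
    have hc := le_lintegral_circle hH h0 (hρ.2.trans_le hbR)
    simp only [norm_circleMap_zero, sq_abs]
    calc _ ≤ _ := mul_le_mul_left hc _
      _ = ENNReal.ofReal ρ * ENNReal.ofReal (1 / ρ ^ 2) * _ := by
        rw [← ENNReal.ofReal_mul h0.le, mul_comm]
        congr 2
        field_simp
      _ = _ := by
        rw [mul_assoc, ← lintegral_const_mul' _ _ ENNReal.ofReal_ne_top]
        congr! 3 with θ
        rw [← ENNReal.ofReal_mul (by positivity)]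
        congr 1
        ring
  · refine ENNReal.continuous_ofReal.comp_continuousOn ?_
    refine ContinuousOn.div (hH.continuousOn.norm.mono ?_) (by fun_prop) fun z hz => ?_
    · exact fun z hz => by simpa using hz.2.trans_le hbR
    · have := ha.trans hz.1
      positivity

/-- Intended for `T z = z * H z`: both `T` and `1/T` then map the annulus `ε < |z| < r` into `bε <
|w| < 1/(bε)`. Near `0` the lower bound comes from `|H| > b`, elsewhere from the positive minimum of
`|H|` and the smallness of `ε`. -/
theorem exists_annulus_bounds {H : ℂ → ℂ} (hH : ContinuousOn H (ball 0 1))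
    (h0 : ∀ z ∈ ball (0 : ℂ) 1, H z ≠ 0) {b r : ℝ} (hb : 0 < b) (hbH : b < ‖H 0‖) (hr : 0 < r)
    (hr1 : r < 1) :
    ∃ ε, 0 < ε ∧ ε < r ∧ b * ε < 1 ∧
      ∀ z : ℂ, ε < ‖z‖ → ‖z‖ < r → b * ε < ‖z * H z‖ ∧ ‖z * H z‖ < 1 / (b * ε) := by
  have hsub : closedBall (0 : ℂ) r ⊆ ball 0 1 := closedBall_subset_ball hr1
  have hc := isCompact_closedBall (0 : ℂ) r
  have hcont : ContinuousOn (fun z => ‖H z‖) (closedBall 0 r) := (hH.mono hsub).norm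
  have hne : (closedBall (0 : ℂ) r).Nonempty := ⟨0, by simpa using hr.le⟩
  obtain ⟨z₁, hz₁, hmin⟩ := hc.exists_isMinOn hne hcont
  obtain ⟨z₂, -, hmax⟩ := hc.exists_isMaxOn hne hcont
  set μ := ‖H z₁‖
  set M := ‖H z₂‖
  have hμ : 0 < μ := norm_pos_iff.2 (h0 _ (hsub hz₁))
  have hev : ∀ᶠ z in 𝓝 (0 : ℂ), b < ‖H z‖ :=
    ((hH.continuousAt (ball_mem_nhds _ one_pos)).norm).eventually (lt_mem_nhds hbH)
  obtain ⟨δ, hδ, hδH⟩ := Metric.eventually_nhds_iff.1 hev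
  have hlt : ∀ c k : ℝ, 0 < k → ∀ᶠ ε in 𝓝[>] (0 : ℝ), c * ε < k := fun c k hk => by
    have : Tendsto (fun ε : ℝ => c * ε) (𝓝 0) (𝓝 0) := by
      simpa using (continuous_const_mul c).tendsto 0
    exact (this.mono_left nhdsWithin_le_nhds).eventually (gt_mem_nhds hk)
  obtain ⟨ε, e1, e2, e3, e4, e5⟩ := ((hlt 1 r hr).and <| (hlt b 1 one_pos).and <|
    (hlt b (δ * μ) (by positivity)).and <| (hlt (b * M) 1 one_pos).and
      self_mem_nhdsWithin).exists
  have e5 : 0 < ε := e5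
  refine ⟨ε, e5, by linarith, e2, fun z hz hzr => ?_⟩
  have hzr' : z ∈ closedBall (0 : ℂ) r := by simpa using hzr.le
  have hm1 : μ ≤ ‖H z‖ := hmin hzr'
  have hm2 : ‖H z‖ ≤ M := hmax hzr'
  have hz0 : 0 < ‖z‖ := e5.trans hz
  rw [norm_mul]
  constructor
  · by_cases h : ‖z‖ < δ
    · have := hδH (y := z) (by simpa using h)
      rw [mul_comm b]
      exact mul_lt_mul'' hz this e5.le hb.le
    · exact e3.trans_le (mul_le_mul (not_lt.1 h) hm1 hμ.le hz0.le)
  · rw [lt_div_iff₀ (by positivity)]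
    calc ‖z‖ * ‖H z‖ * (b * ε) ≤ 1 * M * (b * ε) := by gcongr; linarith
      _ = b * M * ε := by ring
      _ < 1 := e4

/-- A univalent function on the unit disk vanishing at `0` and never taking reciprocal values
satisfies `|T'(0)| ≤ 1`. -/
theorem norm_deriv_le_one_of_mul_ne_one {T : ℂ → ℂ} (hT : DifferentiableOn ℂ T (ball 0 1))
    (hinj : InjOn T (ball 0 1)) (h0 : T 0 = 0)
    (hne : ∀ z ∈ ball (0 : ℂ) 1, ∀ w ∈ ball (0 : ℂ) 1, T z * T w ≠ 1) : ‖deriv T 0‖ ≤ 1 := by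
  by_contra! ha
  have hmem0 : (0 : ℂ) ∈ ball (0 : ℂ) 1 := by simp
  obtain ⟨b, hb1, hba⟩ := exists_between ha
  have hb0 : 0 < b := one_pos.trans hb1
  -- The inequality `1/b < r` is what the comparison of areas will contradict.
  obtain ⟨r, hbr, hr1⟩ := exists_between (inv_lt_one_of_one_lt₀ hb1)
  have hr0 : 0 < r := (inv_pos.2 hb0).trans hbr
  set H := dslope T 0 with hHdef
  have hHd : DifferentiableOn ℂ H (ball 0 1) :=
    (differentiableOn_dslope (ball_mem_nhds _ one_pos)).2 hT
  have hTH : ∀ z, T z = z * H z := fun z => by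
    have := sub_smul_dslope T 0 z
    simpa [h0] using this.symm
  have hTne : ∀ z ∈ ball (0 : ℂ) 1, z ≠ 0 → T z ≠ 0 := fun z hz hz0 h =>
    hz0 (hinj hz hmem0 (h.trans h0.symm))
  have hH00 : H 0 = deriv T 0 := dslope_same _ _
  have hHne : ∀ z ∈ ball (0 : ℂ) 1, H z ≠ 0 := fun z hz h => by
    by_cases hz0 : z = 0
    · rw [hz0, hH00] at h
      rw [h, norm_zero] at ha
      linarith
    · exact hTne z hz hz0 (by rw [hTH, h, mul_zero])
  obtain ⟨ε, hε0, hεr, hbε, hbd⟩ := exists_annulus_bounds hHd.continuousOn hHne hb0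
    (by rwa [hH00]) hr0 hr1
  have hbε0 : 0 < b * ε := by positivity
  set A := openAnnulus ε r
  have hAm : MeasurableSet A := (isOpen_openAnnulus _ _).measurableSet
  have hAball : A ⊆ ball 0 1 := fun z hz => by simpa using hz.2.trans hr1
  have hA0 : ∀ z ∈ A, z ≠ 0 := fun z hz => norm_pos_iff.1 (hε0.trans hz.1)
  have hTd : ∀ z ∈ A, HasDerivAt T (deriv T z) z := fun z hz =>
    (hT.differentiableAt (isOpen_ball.mem_nhds (hAball hz))).hasDerivAt
  have hTA : ∀ z ∈ A, T z ≠ 0 := fun z hz => hTne z (hAball hz) (hA0 z hz)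
  have hTid : ∀ z ∈ A, HasDerivAt (fun z => (T z)⁻¹) (-deriv T z / T z ^ 2) z := fun z hz =>
    (hTd z hz).inv (hTA z hz)
  have hinj' : InjOn (fun z => (T z)⁻¹) A := fun z hz w hw h =>
    hinj (hAball hz) (hAball hw) (inv_injective h)
  -- Here `K = (z T'/T)^2`, with its removable singularity at `0` filled, so that `K 0 = 1`.
  set K : ℂ → ℂ := fun z => (deriv T z / H z) ^ 2
  have hK : DifferentiableOn ℂ K (ball 0 1) := ((hT.deriv isOpen_ball).div hHd hHne).pow 2
  have hK0 : K 0 = 1 := by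
    simp only [K, hH00]
    rw [div_self, one_pow]
    rw [← hH00]; exact hHne 0 hmem0
  have hKA : ∀ z ∈ A, ‖K z‖ / ‖z‖ ^ 2 = ‖deriv T z‖ ^ 2 / ‖T z‖ ^ 2 := fun z hz => by
    have h1 := norm_pos_iff.2 (hA0 z hz)
    have h2 := norm_pos_iff.2 (hHne z (hAball hz))
    rw [hTH z]
    simp only [K, norm_pow, norm_div, norm_mul]
    field_simp
  have hlow := le_lintegral_openAnnulus hK hε0 hεr.le hr1.le
  rw [hK0, norm_one, mul_one] at hlow
  have hS1 : ENNReal.ofReal (2 * Real.pi * Real.log (r / ε)) ≤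
      ∫⁻ w in T '' A, ENNReal.ofReal (1 / ‖w‖ ^ 2) := by
    rw [lintegral_image_eq_lintegral_normSq_deriv_mul hAm hTd (hinj.mono hAball)]
    refine hlow.trans_eq (setLIntegral_congr_fun hAm fun z hz => ?_)
    rw [hKA z hz, ← ENNReal.ofReal_mul (by positivity)]
    congr 1; ring
  have hS2 : ENNReal.ofReal (2 * Real.pi * Real.log (r / ε)) ≤
      ∫⁻ w in (fun z => (T z)⁻¹) '' A, ENNReal.ofReal (1 / ‖w‖ ^ 2) := by
    rw [lintegral_image_eq_lintegral_normSq_deriv_mul hAm hTid hinj']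
    refine hlow.trans_eq (setLIntegral_congr_fun hAm fun z hz => ?_)
    have := norm_pos_iff.2 (hTA z hz)
    rw [hKA z hz, ← ENNReal.ofReal_mul (by positivity)]
    congr 1
    simp only [norm_div, norm_neg, norm_pow, norm_inv]
    field_simp
  have hdisj : Disjoint (T '' A) ((fun z => (T z)⁻¹) '' A) := by
    rw [Set.disjoint_left]
    rintro _ ⟨z, hz, rfl⟩ ⟨w, hw, h⟩
    refine hne z (hAball hz) w (hAball hw) ?_
    simp only at h
    rw [← h, inv_mul_cancel₀ (hTA w hw)]
  have hsub : T '' A ∪ (fun z => (T z)⁻¹) '' A ⊆ openAnnulus (b * ε) (1 / (b * ε)) := by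
    rintro _ (⟨z, hz, rfl⟩ | ⟨z, hz, rfl⟩)
    · rw [hTH z]; exact hbd z hz.1 hz.2
    · have h1 := hbd z hz.1 hz.2
      rw [← hTH z] at h1
      have := norm_pos_iff.2 (hTA z hz)
      simp only [openAnnulus, mem_ofPred_eq, norm_inv, one_div]
      refine ⟨?_, inv_strictAnti₀ hbε0 h1.1⟩
      rw [lt_inv_comm₀ hbε0 this, ← one_div]
      exact h1.2
  have hmeas : MeasurableSet ((fun z => (T z)⁻¹) '' A) :=
    hAm.image_of_continuousOn_injOn
      (fun z hz => (hTid z hz).continuousAt.continuousWithinAt) hinj'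
  -- The two images are disjoint, each of logarithmic area at least `2π log (r/ε)`, inside an
  -- annulus of logarithmic area `-4π log (bε)`. The terms in `ε` cancel, leaving `r ≤ 1/b`.
  have key := lintegral_mono_set (μ := volume) (f := fun w : ℂ => ENNReal.ofReal (1 / ‖w‖ ^ 2)) hsub
  rw [lintegral_union hmeas hdisj, lintegral_openAnnulus_one_div_sq hbε0
    ((le_div_iff₀ hbε0).2 (by nlinarith))] at key
  have key2 := (add_le_add hS1 hS2).trans key
  have hL : 0 ≤ Real.log (r / ε) := Real.log_nonneg ((one_le_div hε0).2 hεr.le)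
  have hπ := Real.pi_pos
  rw [← ENNReal.ofReal_add (by positivity) (by positivity),
    ENNReal.ofReal_le_ofReal_iff' ] at key2
  have hlog : Real.log (1 / (b * ε) / (b * ε)) = -2 * Real.log b - 2 * Real.log ε := by
    rw [div_div, one_div, Real.log_inv, Real.log_mul hbε0.ne' hbε0.ne',
      Real.log_mul hb0.ne' hε0.ne']
    ring
  have hlr : -Real.log b < Real.log r := by
    rw [← Real.log_inv]; exact Real.log_lt_log (inv_pos.2 hb0) hbr
  have hLpos : 0 < Real.log (r / ε) := Real.log_pos ((one_lt_div hε0).2 hεr)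
  rw [hlog] at key2
  have hLe : Real.log (r / ε) = Real.log r - Real.log ε := Real.log_div hr0.ne' hε0.ne'
  rcases key2 with h | h
  · rw [hLe] at h
    nlinarith
  · nlinarith [mul_pos hπ hLpos]

/-! ### Koebe theorems for univalent functions omitting a value -/

/-- A holomorphic logarithm of `F - p` on a disk where `F` omits the value `p`. -/
theorem exists_log_sub {F : ℂ → ℂ} {a p : ℂ} {R : ℝ} (hR : 0 < R)
    (hF : DifferentiableOn ℂ F (ball a R)) (hp : ∀ z ∈ ball a R, F z ≠ p) :
    ∃ P : ℂ → ℂ, ∀ z ∈ ball a R,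
      HasDerivAt P (deriv F z / (F z - p)) z ∧ exp (P z) = F z - p := by
  have hne : ∀ z ∈ ball a R, F z - p ≠ 0 := fun z hz => sub_ne_zero.2 (hp z hz)
  have hd : DifferentiableOn ℂ (fun z => deriv F z / (F z - p)) (ball a R) :=
    (hF.deriv isOpen_ball).div (hF.sub_const p) hne
  obtain ⟨P, hP0, hP⟩ := hd.isExactOn_ball.with_val_at a (log (F a - p))
  have ha : a ∈ ball a R := mem_ball_self hR
  have hconst : ∀ z ∈ ball a R, HasDerivAt (fun z => (F z - p) * exp (-P z)) 0 z := fun z hz => by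
    have h1 := ((hF.differentiableAt (isOpen_ball.mem_nhds hz)).hasDerivAt.sub_const p).mul
      (hP z hz).neg.cexp
    convert! h1 using 1
    have := hne z hz
    field_simp
    ring
  refine ⟨P, fun z hz => ⟨hP z hz, ?_⟩⟩
  have h1 := isOpen_ball.is_const_of_deriv_eq_zero (convex_ball a R).isPreconnected
    (fun z hz => (hconst z hz).differentiableAt.differentiableWithinAt)
    (fun z hz => (hconst z hz).deriv) hz ha
  simp only [hP0] at h1
  rw [exp_neg (log _), exp_log (hne a ha), mul_inv_cancel₀ (hne a ha), exp_neg] at h1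
  field_simp at h1
  exact h1.symm

/-- **Koebe quarter theorem**, for a univalent function omitting the value `p`. -/
theorem koebe_quarter {F : ℂ → ℂ} (hF : DifferentiableOn ℂ F (ball 0 1))
    (hinj : InjOn F (ball 0 1)) {p : ℂ} (hp : ∀ z ∈ ball (0 : ℂ) 1, F z ≠ p) :
    ‖deriv F 0‖ ≤ 4 * ‖F 0 - p‖ := by
  have hmem0 : (0 : ℂ) ∈ ball (0 : ℂ) 1 := by simp
  obtain ⟨P, hP⟩ := exists_log_sub one_pos hF hp
  -- `Q` is a square root of `F - p`. Univalence of `F` excludes `Q z = -Q w`, which is exactly the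
  -- condition that `T = (Q - Q 0) / (Q + Q 0)` takes no pair of reciprocal values. The bound `|T'
  -- 0| ≤ 1` reads `|Q' 0| ≤ 2 |Q 0|`, and `F' 0 = 2 Q 0 Q' 0`.
  set Q : ℂ → ℂ := fun z => exp (P z / 2) with hQdef
  have hQsq : ∀ z ∈ ball (0 : ℂ) 1, Q z ^ 2 = F z - p := fun z hz => by
    rw [← (hP z hz).2, ← exp_nat_mul]
    congr 1; push_cast; ring
  have hQ0 : ∀ z, Q z ≠ 0 := fun z => exp_ne_zero _
  have hQd : ∀ z ∈ ball (0 : ℂ) 1, DifferentiableAt ℂ Q z := fun z hz =>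
    ((hP z hz).1.differentiableAt.div_const 2).cexp
  have hQF : ∀ z ∈ ball (0 : ℂ) 1, ∀ w ∈ ball (0 : ℂ) 1, Q z ^ 2 = Q w ^ 2 → z = w :=
    fun z hz w hw h => hinj hz hw (by rw [hQsq z hz, hQsq w hw] at h; exact sub_left_injective h)
  have hQsum : ∀ z ∈ ball (0 : ℂ) 1, ∀ w ∈ ball (0 : ℂ) 1, Q z + Q w ≠ 0 := fun z hz w hw h => by
    have e : Q z = -Q w := eq_neg_of_add_eq_zero_left h
    have := hQF z hz w hw (by rw [e]; ring)
    rw [this] at h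
    exact hQ0 w (by linear_combination h / 2)
  have hTd : ∀ z ∈ ball (0 : ℂ) 1, DifferentiableAt ℂ (fun z => (Q z - Q 0) / (Q z + Q 0)) z :=
    fun z hz => ((hQd z hz).sub_const _).div ((hQd z hz).add_const _) (hQsum z hz 0 hmem0)
  have key := norm_deriv_le_one_of_mul_ne_one (T := fun z => (Q z - Q 0) / (Q z + Q 0))
    (fun z hz => (hTd z hz).differentiableWithinAt) ?_ (by simp) ?_
  · have hQ' := (hQd 0 hmem0).hasDerivAt
    have hT' : deriv (fun z => (Q z - Q 0) / (Q z + Q 0)) 0 = deriv Q 0 / (2 * Q 0) := by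
      refine ((hQ'.sub_const (Q 0)).div (hQ'.add_const (Q 0)) (hQsum 0 hmem0 0 hmem0)).deriv.trans ?_
      have := hQ0 0
      field_simp
      ring
    have hF' : deriv F 0 = 2 * Q 0 * deriv Q 0 := by
      have h1 : (fun z => F z) =ᶠ[𝓝 0] fun z => Q z ^ 2 + p := by
        filter_upwards [isOpen_ball.mem_nhds hmem0] with z hz
        rw [hQsq z hz]; ring
      refine h1.deriv_eq.trans (((hQ'.pow 2).add_const p).deriv.trans ?_)
      push_cast; ring
    rw [hT', norm_div, div_le_one (norm_pos_iff.2 (by simpa using hQ0 0)), norm_mul] at key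
    rw [hF', ← hQsq 0 hmem0, norm_mul, norm_mul, norm_pow]
    simp only [Complex.norm_ofNat] at key ⊢
    nlinarith [norm_nonneg (Q 0)]
  · intro z hz w hw h
    refine hQF z hz w hw ?_
    have h1 := hQsum z hz 0 hmem0
    have h2 := hQsum w hw 0 hmem0
    simp only at h
    rw [div_eq_div_iff h1 h2] at h
    have h3 : Q 0 * (Q z - Q w) = 0 := by linear_combination h / 2
    have h4 := (mul_eq_zero.1 h3).resolve_left (hQ0 0)
    rw [sub_eq_zero.1 h4]
  · intro z hz w hw h
    have h1 := hQsum z hz 0 hmem0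
    have h2 := hQsum w hw 0 hmem0
    rw [div_mul_div_comm, div_eq_one_iff_eq (mul_ne_zero h1 h2)] at h
    have h3 : Q 0 * (Q z + Q w) = 0 := by linear_combination -h / 2
    exact hQsum z hz w hw ((mul_eq_zero.1 h3).resolve_left (hQ0 0))

/-- The Koebe quarter theorem at a point of the real diameter. -/
theorem koebe_quarter_ofReal {F : ℂ → ℂ} (hF : DifferentiableOn ℂ F (ball 0 1))
    (hinj : InjOn F (ball 0 1)) {p : ℂ} (hp : ∀ z ∈ ball (0 : ℂ) 1, F z ≠ p) {x : ℝ}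
    (hx0 : 0 ≤ x) (hx1 : x < 1) :
    ‖deriv F x‖ * (1 - x ^ 2) ≤ 4 * ‖F x - p‖ := by
  have hmem0 : (0 : ℂ) ∈ ball (0 : ℂ) 1 := by simp
  have hden : ∀ u ∈ ball (0 : ℂ) 1, 1 + x * u ≠ 0 := fun u hu h => by
    have h1 : (x : ℂ) * u = -1 := by linear_combination h
    have h2 : x * ‖u‖ = 1 := by simpa [abs_of_nonneg hx0] using congrArg norm h1
    have h3 : ‖u‖ < 1 := by simpa using hu
    nlinarith [norm_nonneg u]
  -- The disk automorphism taking `0` to `x`, with derivative `1 - x^2` at `0`.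
  set M : ℂ → ℂ := fun u => (u + x) / (1 + x * u) with hM
  have hMd : ∀ u ∈ ball (0 : ℂ) 1, HasDerivAt M ((1 - x ^ 2) / (1 + x * u) ^ 2) u := fun u hu => by
    have h := ((hasDerivAt_id u).add_const (x : ℂ)).div
      (((hasDerivAt_id u).const_mul (x : ℂ)).const_add 1) (hden u hu)
    convert! h using 1
    simp only [id]
    ring
  have hMm : MapsTo M (ball 0 1) (ball 0 1) := fun u hu => by
    have h3 : ‖u‖ < 1 := by simpa using hu
    have h4 : 0 < ‖1 + x * u‖ := norm_pos_iff.2 (hden u hu)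
    rw [mem_ball_zero_iff, hM, norm_div, div_lt_one h4]
    refine lt_of_pow_lt_pow_left₀ 2 h4.le ?_
    have h5 : ‖u‖ ^ 2 < 1 := by nlinarith [norm_nonneg u]
    rw [← Complex.normSq_eq_norm_sq, Complex.normSq_apply] at h5 ⊢
    rw [← Complex.normSq_eq_norm_sq, Complex.normSq_apply]
    simp only [add_re, add_im, mul_re, mul_im, ofReal_re, ofReal_im, one_re, one_im]
    nlinarith [mul_pos (show 0 < 1 - x ^ 2 by nlinarith)
      (show 0 < 1 - (u.re * u.re + u.im * u.im) by linarith)]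
  have hMinj : InjOn M (ball 0 1) := fun u hu v hv h => by
    simp only [hM] at h
    rw [div_eq_div_iff (hden u hu) (hden v hv)] at h
    have h1 : (1 - (x : ℂ) ^ 2) * (u - v) = 0 := by linear_combination h
    have h2 : (1 - (x : ℂ) ^ 2) ≠ 0 := by
      norm_cast
      nlinarith
    exact sub_eq_zero.1 ((mul_eq_zero.1 h1).resolve_left h2)
  have hM0 : M 0 = x := by simp [hM]
  have hcomp : DifferentiableOn ℂ (F ∘ M) (ball 0 1) :=
    hF.comp (fun u hu => (hMd u hu).differentiableAt.differentiableWithinAt) hMm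
  have key := koebe_quarter hcomp (hinj.comp hMinj hMm) (p := p) (fun z hz => hp _ (hMm hz))
  have hxm : (x : ℂ) ∈ ball (0 : ℂ) 1 := by simpa [abs_of_nonneg hx0] using hx1
  have hFd : HasDerivAt F (deriv F x) (M 0) := by
    rw [hM0]
    exact (hF.differentiableAt (isOpen_ball.mem_nhds hxm)).hasDerivAt
  rw [(hFd.comp 0 (hMd 0 hmem0)).deriv, Function.comp_apply, hM0, norm_mul] at key
  convert! key using 2
  have h1 : (0 : ℝ) ≤ 1 - x ^ 2 := by nlinarith
  have : ((1 - (x : ℂ) ^ 2) / (1 + x * 0) ^ 2) = ((1 - x ^ 2 : ℝ) : ℂ) := by push_cast; simp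
  rw [this, norm_real, Real.norm_of_nonneg h1]

/-- Growth of a univalent function omitting the value `p`, measured from `p`. -/
theorem norm_sub_le_of_omits {F : ℂ → ℂ} (hF : DifferentiableOn ℂ F (ball 0 1))
    (hinj : InjOn F (ball 0 1)) {p : ℂ} (hp : ∀ z ∈ ball (0 : ℂ) 1, F z ≠ p) {x : ℝ}
    (hx0 : 0 ≤ x) (hx1 : x < 1) :
    ‖F x - p‖ ≤ ‖F 0 - p‖ * ((1 + x) / (1 - x)) ^ 2 := by
  obtain ⟨P, hP⟩ := exists_log_sub one_pos hF hp
  have hmem : ∀ t : ℝ, 0 ≤ t → t < 1 → (t : ℂ) ∈ ball (0 : ℂ) 1 := fun t h0 h1 => by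
    simpa [abs_of_nonneg h0] using h1
  have hd : ∀ t ∈ Icc 0 x, HasDerivAt (fun t : ℝ => P t - P 0)
      (deriv F t / (F t - p)) t := fun t ht =>
    ((hP t (hmem t ht.1 (ht.2.trans_lt hx1))).1.comp_ofReal).sub_const _
  have hB : ∀ t ∈ Icc 0 x, HasDerivAt (fun t : ℝ => 2 * (Real.log (1 + t) - Real.log (1 - t)))
      (4 / (1 - t ^ 2)) t := fun t ht => by
    have h1 : 0 < 1 - t := by linarith [ht.2]
    have h2 : 0 < 1 + t := by linarith [ht.1]
    have h := ((((hasDerivAt_id t).const_add 1).log h2.ne').sub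
      (((hasDerivAt_id t).const_sub 1).log h1.ne')).const_mul 2
    convert! h using 1
    simp only [id]
    have : 1 - t ^ 2 = (1 - t) * (1 + t) := by ring
    rw [this]
    field_simp
    ring
  -- The quarter theorem at `t` says `|P'| ≤ 4 / (1 - t^2)` for the logarithm `P` of `F - p`; this
  -- is integrated from `0` to `x`.
  have key := image_norm_le_of_norm_deriv_right_le_deriv_boundary' (a := 0) (b := x)
    (fun t ht => (hd t ht).continuousAt.continuousWithinAt)
    (fun t ht => (hd t (Ico_subset_Icc_self ht)).hasDerivWithinAt)
    (B := fun t : ℝ => 2 * (Real.log (1 + t) - Real.log (1 - t))) (by simp)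
    (fun t ht => (hB t ht).continuousAt.continuousWithinAt)
    (fun t ht => (hB t (Ico_subset_Icc_self ht)).hasDerivWithinAt)
    (fun t ht => by
      have ht1 := ht.2.trans hx1
      have h1 : 0 < 1 - t ^ 2 := by nlinarith [ht.1]
      have h2 : 0 < ‖F t - p‖ := norm_pos_iff.2 (sub_ne_zero.2 (hp _ (hmem t ht.1 ht1)))
      rw [norm_div, div_le_div_iff₀ h2 h1]
      exact koebe_quarter_ofReal hF hinj hp ht.1 ht1)
    (right_mem_Icc.2 hx0)
  have h1 : 0 < 1 - x := by linarith
  have h2 : 0 < 1 + x := by linarith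
  have e1 : ‖F x - p‖ = Real.exp (P x).re := by
    rw [← (hP x (hmem x hx0 hx1)).2, norm_exp]
  have e2 : ‖F 0 - p‖ = Real.exp (P 0).re := by
    rw [← (hP 0 (by simp)).2, norm_exp]
  have e3 : ((1 + x) / (1 - x)) ^ 2 =
      Real.exp (2 * (Real.log (1 + x) - Real.log (1 - x))) := by
    rw [← Real.log_div h2.ne' h1.ne', mul_comm, Real.exp_mul, Real.exp_log (by positivity)]
    norm_cast
  rw [e1, e2, e3, ← Real.exp_add, Real.exp_le_exp]
  have := (re_le_norm (P x - P 0)).trans key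
  rw [sub_re] at this
  linarith

/-- **Koebe growth theorem**, for a univalent function omitting the value `p`. -/
theorem koebe_growth {F : ℂ → ℂ} (hF : DifferentiableOn ℂ F (ball 0 1))
    (hinj : InjOn F (ball 0 1)) {p : ℂ} (hp : ∀ z ∈ ball (0 : ℂ) 1, F z ≠ p) {x : ℝ}
    (hx0 : 0 ≤ x) (hx1 : x < 1) :
    ‖F x - F 0‖ ≤ 4 * ‖F 0 - p‖ * (x / (1 - x) ^ 2) := by
  have hmem : ∀ t : ℝ, 0 ≤ t → t < 1 → (t : ℂ) ∈ ball (0 : ℂ) 1 := fun t h0 h1 => by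
    simpa [abs_of_nonneg h0] using h1
  have hd : ∀ t ∈ Icc 0 x, HasDerivAt (fun t : ℝ => F t - F 0) (deriv F t) t := fun t ht =>
    ((hF.differentiableAt (isOpen_ball.mem_nhds
      (hmem t ht.1 (ht.2.trans_lt hx1)))).hasDerivAt.comp_ofReal).sub_const _
  have hB : ∀ t ∈ Icc 0 x, HasDerivAt (fun t : ℝ => 4 * ‖F 0 - p‖ * (t / (1 - t) ^ 2))
      (4 * ‖F 0 - p‖ * ((1 + t) / (1 - t) ^ 3)) t := fun t ht => by
    have h1 : 0 < 1 - t := by linarith [ht.2]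
    have h := ((hasDerivAt_id t).div (((hasDerivAt_id t).const_sub 1).pow 2)
      (pow_pos h1 2).ne').const_mul (4 * ‖F 0 - p‖)
    convert! h using 1
    simp only [id, Pi.pow_apply]
    field_simp
    push_cast
    ring
  exact image_norm_le_of_norm_deriv_right_le_deriv_boundary' (a := 0) (b := x)
    (fun t ht => (hd t ht).continuousAt.continuousWithinAt)
    (fun t ht => (hd t (Ico_subset_Icc_self ht)).hasDerivWithinAt)
    (by simp)
    (fun t ht => (hB t ht).continuousAt.continuousWithinAt)
    (fun t ht => (hB t (Ico_subset_Icc_self ht)).hasDerivWithinAt)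
    (fun t ht => by
      have ht1 := ht.2.trans hx1
      have h1 : 0 < 1 - t := by linarith
      have h2 : 0 < 1 + t := by linarith [ht.1]
      have h3 := koebe_quarter_ofReal hF hinj hp ht.1 ht1
      have h4 := norm_sub_le_of_omits hF hinj hp ht.1 ht1
      have h5 : 0 < 1 - t ^ 2 := by nlinarith
      rw [← le_div_iff₀ h5] at h3
      refine h3.trans ?_
      rw [div_le_iff₀ h5]
      calc 4 * ‖F t - p‖ ≤ 4 * (‖F 0 - p‖ * ((1 + t) / (1 - t)) ^ 2) := by gcongr
        _ = _ := by field_simp; ring)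
    (right_mem_Icc.2 hx0)

/-! ### Holomorphic branches of the inverse -/

namespace NewtonFlow

theorem exists_local_inverse {f : ℂ[X]} {c : ℂ} (hc : (derivative f).eval c ≠ 0) :
    ∃ h : ℂ → ℂ, h (f.eval c) = c ∧ (∀ᶠ x in 𝓝 c, h (f.eval x) = x) ∧
      ∃ δ > 0, DifferentiableOn ℂ h (ball (f.eval c) δ) ∧
        ∀ w ∈ ball (f.eval c) δ, f.eval (h w) = w := by
  have hs := (f.hasStrictDerivAt c).hasStrictFDerivAt_equiv hc
  set h := hs.localInverse (fun x => f.eval x) _ c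
  have hl : ∀ᶠ x in 𝓝 c, h (f.eval x) = x := hs.eventually_left_inverse
  have hne : ∀ᶠ x in 𝓝 c, (derivative f).eval x ≠ 0 :=
    (derivative f).continuous.continuousAt.eventually_ne hc
  have hd : ∀ᶠ x in 𝓝 c, DifferentiableAt ℂ h (f.eval x) := by
    filter_upwards [hl.eventually_nhds, hne] with x hx hx'
    exact ((f.hasStrictDerivAt x).to_local_left_inverse hx' hx).hasDerivAt.differentiableAt
  have hr : ∀ᶠ w in 𝓝 (f.eval c), f.eval (h w) = w := hs.eventually_right_inverse
  have ht : Tendsto h (𝓝 (f.eval c)) (𝓝 c) := hs.localInverse_tendsto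
  obtain ⟨δ, hδ, hball⟩ := Metric.eventually_nhds_iff_ball.1 (hr.and (ht.eventually hd))
  refine ⟨h, hl.self_of_nhds, hl, δ, hδ, fun w hw => ?_, fun w hw => (hball w hw).1⟩
  have := hball w hw
  rw [this.1] at this
  exact this.2.differentiableWithinAt

/-- `g` is a holomorphic right inverse of `f` on the open set `U`. -/
structure IsBranchOn (f : ℂ[X]) (g : ℂ → ℂ) (U : Set ℂ) : Prop where
  isOpen : IsOpen U
  differentiableOn : DifferentiableOn ℂ g U
  eval_eq : ∀ w ∈ U, f.eval (g w) = w

namespace IsBranchOn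

variable {f : ℂ[X]} {g : ℂ → ℂ} {U : Set ℂ}

theorem mono (hg : IsBranchOn f g U) {V : Set ℂ} (hV : IsOpen V) (h : V ⊆ U) :
    IsBranchOn f g V :=
  ⟨hV, hg.differentiableOn.mono h, fun w hw => hg.eval_eq w (h hw)⟩

theorem injOn (hg : IsBranchOn f g U) : InjOn g U := fun w hw v hv h => by
  rw [← hg.eval_eq w hw, h, hg.eval_eq v hv]

theorem hasDerivAt' (hg : IsBranchOn f g U) {w : ℂ} (hw : w ∈ U) :
    HasDerivAt g (deriv g w) w :=
  (hg.differentiableOn.differentiableAt (hg.isOpen.mem_nhds hw)).hasDerivAt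

theorem continuousAt (hg : IsBranchOn f g U) {w : ℂ} (hw : w ∈ U) : ContinuousAt g w :=
  (hg.hasDerivAt' hw).continuousAt

theorem eval_derivative_mul_deriv (hg : IsBranchOn f g U) {w : ℂ} (hw : w ∈ U) :
    (derivative f).eval (g w) * deriv g w = 1 := by
  have h1 := (f.hasDerivAt (g w)).comp w (hg.hasDerivAt' hw)
  have h2 : (fun w => f.eval (g w)) =ᶠ[𝓝 w] id :=
    (hg.isOpen.eventually_mem hw).mono fun v hv => hg.eval_eq v hv
  exact (h1.congr_of_eventuallyEq h2.symm).unique (hasDerivAt_id w)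

theorem eval_derivative_ne_zero (hg : IsBranchOn f g U) {w : ℂ} (hw : w ∈ U) :
    (derivative f).eval (g w) ≠ 0 :=
  left_ne_zero_of_mul_eq_one (hg.eval_derivative_mul_deriv hw)

theorem hasDerivAt (hg : IsBranchOn f g U) {w : ℂ} (hw : w ∈ U) :
    HasDerivAt g ((derivative f).eval (g w))⁻¹ w := by
  rw [← eq_inv_of_mul_eq_one_right (hg.eval_derivative_mul_deriv hw)]
  exact hg.hasDerivAt' hw

/-- A branch agrees near `w` with the local inverse at `g w`, hence is a left inverse there too.
This makes the sets `{x | g (f x) = x}` used below open. -/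
theorem eventually_apply_eval (hg : IsBranchOn f g U) {w : ℂ} (hw : w ∈ U) :
    ∀ᶠ x in 𝓝 (g w), g (f.eval x) = x := by
  obtain ⟨h, -, hl, -⟩ := exists_local_inverse (hg.eval_derivative_ne_zero hw)
  have h1 : ∀ᶠ v in 𝓝 w, h v = g v := by
    filter_upwards [(hg.continuousAt hw).eventually hl, hg.isOpen.eventually_mem hw] with v h1 h2
    rwa [hg.eval_eq v h2] at h1
  have h2 : Tendsto (fun x => f.eval x) (𝓝 (g w)) (𝓝 w) := by
    have := f.continuous.tendsto (g w)
    rwa [hg.eval_eq w hw] at this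
  filter_upwards [h2.eventually h1, hl] with x hx hx'
  rw [← hx, hx']

end IsBranchOn

/-! ### Newton flow and basins -/

theorem hasDerivWithinAt_eval_comp {f : ℂ[X]} {φ : ℝ → ℂ} {s : Set ℝ} {t : ℝ}
    (h : HasDerivWithinAt φ (rescaledField f (φ t)) s t) :
    HasDerivWithinAt (fun t => f.eval (φ t))
      (-(‖(derivative f).eval (φ t)‖ ^ 2 : ℝ) * f.eval (φ t)) s t := by
  have h1 := (f.hasDerivAt (φ t)).comp_hasDerivWithinAt t h
  convert! h1 using 1
  rw [rescaledField, ← Complex.normSq_eq_norm_sq, ← Complex.mul_conj]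
  ring

theorem antitoneOn_norm_eval {f : ℂ[X]} {φ : ℝ → ℂ}
    (h : ∀ t : ℝ, 0 ≤ t → HasDerivWithinAt φ (rescaledField f (φ t)) (Ici 0) t) :
    AntitoneOn (fun t => ‖f.eval (φ t)‖ ^ 2) (Ici 0) := by
  have hd : ∀ t ∈ Ici (0 : ℝ), HasDerivWithinAt (fun t => ‖f.eval (φ t)‖ ^ 2)
      (-2 * ‖(derivative f).eval (φ t)‖ ^ 2 * ‖f.eval (φ t)‖ ^ 2) (Ici 0) t := fun t ht => by
    have h1 := (hasDerivWithinAt_eval_comp (h t ht)).norm_sq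
    convert! h1 using 1
    rw [← ofReal_neg, ← Complex.real_smul, real_inner_smul_right, real_inner_self_eq_norm_sq]
    ring
  refine antitoneOn_of_deriv_nonpos (convex_Ici 0) (fun t ht => (hd t ht).continuousWithinAt)
    ?_ ?_
  · rw [interior_Ici]
    exact fun t ht => (((hd t (mem_Ici.2 (le_of_lt ht))).hasDerivAt
      (Ici_mem_nhds ht)).differentiableAt).differentiableWithinAt
  · rw [interior_Ici]
    intro t ht
    rw [((hd t (mem_Ici.2 (le_of_lt ht))).hasDerivAt (Ici_mem_nhds ht)).deriv]
    nlinarith [mul_nonneg (sq_nonneg ‖(derivative f).eval (φ t)‖) (sq_nonneg ‖f.eval (φ t)‖)]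

/-- Points of the basin with small value lie in the range of the inverse branch. -/
theorem apply_eval_of_mem_basin {f : ℂ[X]} {g : ℂ → ℂ} {R : ℝ} {z ζ : ℂ}
    (hg : IsBranchOn f g (ball 0 R)) (hR : 0 < R) (hg0 : g 0 = ζ) (hz : z ∈ basin f ζ)
    (hzR : ‖f.eval z‖ < R) : g (f.eval z) = z := by
  obtain ⟨φ, hφ0, hφ, hlim⟩ := hz
  have hmem : ∀ t, 0 ≤ t → f.eval (φ t) ∈ ball (0 : ℂ) R := fun t ht => by
    have h1 := antitoneOn_norm_eval hφ (mem_Ici.2 le_rfl) (mem_Ici.2 ht) ht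
    simp only [hφ0] at h1
    rw [mem_ball_zero_iff]
    exact (le_of_sq_le_sq h1 (norm_nonneg _)).trans_lt hzR
  -- The orbit is extended by its initial point to negative times, so that connectedness of `ℝ`
  -- applies: `g ∘ f` fixes the orbit on a clopen set of times, which contains all large times.
  set ψ : ℝ → ℂ := fun t => φ (max t 0) with hψ
  have hψc : Continuous ψ := by
    rw [← continuousOn_univ]
    exact ContinuousOn.comp (t := Ici 0) (fun t ht => (hφ t ht).continuousWithinAt)
      (by fun_prop) (fun t _ => mem_Ici.2 (le_max_right _ _))
  have hfψ : ∀ t, f.eval (ψ t) ∈ ball (0 : ℂ) R := fun t => hmem _ (le_max_right _ _)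
  have hclosed : IsClosed {t | g (f.eval (ψ t)) = ψ t} := by
    refine isClosed_eq ?_ hψc
    exact continuous_iff_continuousAt.2 fun t =>
      ContinuousAt.comp (f := fun t => f.eval (ψ t)) (hg.continuousAt (hfψ t))
        (f.continuous.comp hψc).continuousAt
  have hopen : IsOpen {t | g (f.eval (ψ t)) = ψ t} := by
    refine isOpen_iff_mem_nhds.2 fun t ht => ?_
    have h1 := hg.eventually_apply_eval (hfψ t)
    rw [show g (f.eval (ψ t)) = ψ t from ht] at h1
    exact hψc.continuousAt.eventually h1
  have hne : {t | g (f.eval (ψ t)) = ψ t}.Nonempty := by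
    have h1 := hg.eventually_apply_eval (mem_ball_self hR)
    rw [hg0] at h1
    obtain ⟨t, ht, ht0⟩ := ((hlim.eventually h1).and (eventually_ge_atTop 0)).exists
    exact ⟨t, by simpa [hψ, max_eq_left ht0] using ht⟩
  have huniv := IsClopen.eq_univ ⟨hclosed, hopen⟩ hne
  have h0 : (0 : ℝ) ∈ {t | g (f.eval (ψ t)) = ψ t} := huniv ▸ mem_univ _
  simpa [hψ, hφ0] using h0

/-- Global solutions of the autonomous scalar equation `τ' = a(τ)` with `0 < a` bounded. -/
theorem exists_scalar_flow {a : ℝ → ℝ} (ha : Continuous a) (hpos : ∀ x, 0 < a x) {A : ℝ}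
    (hA : ∀ x, a x ≤ A) :
    ∃ τ : ℝ → ℝ, τ 0 = 0 ∧ StrictMono τ ∧ Tendsto τ atTop atTop ∧
      ∀ t, HasDerivAt τ (a (τ t)) t := by
  have hA0 : 0 < A := (hpos 0).trans_le (hA 0)
  have hcont : Continuous fun x => (a x)⁻¹ := ha.inv₀ fun x => (hpos x).ne'
  -- Separation of variables: `τ` is the inverse of `I`. The bound `a ≤ A` gives `I' ≥ 1/A`, so `I`
  -- is onto.
  set I : ℝ → ℝ := fun x => ∫ y in (0 : ℝ)..x, (a y)⁻¹
  have hI : ∀ x, HasDerivAt I (a x)⁻¹ x := fun x =>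
    intervalIntegral.integral_hasDerivAt_right (hcont.intervalIntegrable _ _)
      (hcont.stronglyMeasurableAtFilter _ _) hcont.continuousAt
  have hI0 : I 0 = 0 := by simp [I]
  have hmono : StrictMono I := strictMono_of_deriv_pos fun x => by
    rw [(hI x).deriv]; exact inv_pos.2 (hpos x)
  have hIc : Continuous I := continuous_iff_continuousAt.2 fun x => (hI x).continuousAt
  have hmono2 : Monotone fun x => I x - A⁻¹ * x := by
    refine monotone_of_deriv_nonneg
      (fun x => ((hI x).sub ((hasDerivAt_id x).const_mul A⁻¹)).differentiableAt) fun x => ?_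
    have h1 : deriv (fun x => I x - A⁻¹ * x) x = (a x)⁻¹ - A⁻¹ * 1 :=
      ((hI x).sub ((hasDerivAt_id x).const_mul A⁻¹)).deriv
    rw [h1, mul_one, sub_nonneg]
    exact inv_anti₀ (hpos x) (hA x)
  have htop : Tendsto I atTop atTop := by
    refine tendsto_atTop_mono' _ ?_ (tendsto_id.const_mul_atTop (inv_pos.2 hA0))
    filter_upwards [eventually_ge_atTop 0] with x hx
    have := hmono2 hx
    simp only [hI0] at this
    simp only [id]
    linarith
  have hbot : Tendsto I atBot atBot := by
    refine tendsto_atBot_mono' _ ?_ (tendsto_id.const_mul_atBot (inv_pos.2 hA0))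
    filter_upwards [eventually_le_atBot 0] with x hx
    have := hmono2 hx
    simp only [hI0] at this
    simp only [id]
    linarith
  set e := hmono.orderIsoOfSurjective I (hIc.surjective htop hbot)
  have he : ∀ x, e x = I x := fun x => rfl
  refine ⟨e.symm, ?_, e.symm.strictMono, e.symm.tendsto_atTop, fun t => ?_⟩
  · rw [e.symm_apply_eq, he, hI0]
  · have := HasDerivAt.of_local_left_inverse (f := I) (g := e.symm) (a := t)
      e.symm.continuous.continuousAt (hI _) (inv_pos.2 (hpos _)).ne'
      (Eventually.of_forall fun y => e.apply_symm_apply y)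
    rwa [inv_inv] at this

/-- The range of an inverse branch on a disk around `0` lies in the basin. -/
theorem IsBranchOn.mem_basin {f : ℂ[X]} {g : ℂ → ℂ} {R : ℝ} {ζ w : ℂ}
    (hg : IsBranchOn f g (ball 0 R)) (hg0 : g 0 = ζ) (hw : w ∈ ball (0 : ℂ) R) :
    g w ∈ basin f ζ := by
  have hR : 0 < R := pos_of_mem_ball hw
  set η : ℝ → ℂ := fun x => w * Real.exp (-x) with hη
  have hηn : ∀ x, 0 ≤ x → ‖η x‖ ≤ ‖w‖ := fun x hx => by
    rw [hη, norm_mul, norm_real, Real.norm_of_nonneg (Real.exp_pos _).le]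
    exact mul_le_of_le_one_right (norm_nonneg _) (Real.exp_le_one_iff.2 (by linarith))
  have hw' : ‖w‖ < R := by simpa using hw
  have hηR : ∀ x, 0 ≤ x → η x ∈ ball (0 : ℂ) R := fun x hx => by
    simpa using (hηn x hx).trans_lt hw'
  have hηc : Continuous η := by fun_prop
  set a : ℝ → ℝ := fun x => ‖(derivative f).eval (g (η (max x 0)))‖ ^ 2 with hadef
  have hac : Continuous a := by
    refine Continuous.pow (Continuous.norm ((derivative f).continuous.comp ?_)) 2
    exact continuous_iff_continuousAt.2 fun x => ContinuousAt.comp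
      (f := fun x => η (max x 0)) (hg.continuousAt (hηR _ (le_max_right _ _)))
      (by fun_prop)
  have hapos : ∀ x, 0 < a x := fun x =>
    pow_pos (norm_pos_iff.2 (hg.eval_derivative_ne_zero (hηR _ (le_max_right _ _)))) 2
  obtain ⟨A, hA⟩ : ∃ A, ∀ x, a x ≤ A := by
    have hc : ContinuousOn (fun v => ‖(derivative f).eval (g v)‖ ^ 2) (closedBall 0 ‖w‖) := by
      refine ((derivative f).continuous.comp_continuousOn
        (hg.differentiableOn.continuousOn.mono ?_)).norm.pow 2
      exact closedBall_subset_ball hw'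
    obtain ⟨A, hA⟩ := (isCompact_closedBall (0 : ℂ) ‖w‖).exists_bound_of_continuousOn hc
    refine ⟨A, fun x => (le_abs_self _).trans (hA (η (max x 0)) ?_)⟩
    simpa using hηn _ (le_max_right x 0)
  obtain ⟨τ, hτ0, hτm, hτt, hτd⟩ := exists_scalar_flow hac hapos hA
  have hτn : ∀ t, 0 ≤ t → 0 ≤ τ t := fun t ht => hτ0 ▸ hτm.monotone ht
  refine ⟨fun t => g (η (τ t)), by simp [hτ0, hη], fun t ht => ?_, ?_⟩
  · have h1 : HasDerivAt (fun t => η (τ t)) (w * ((Real.exp (-τ t) * -a (τ t) : ℝ) : ℂ)) t :=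
      (((hτd t).neg.exp).ofReal_comp).const_mul w
    have h2 := (hg.hasDerivAt (hηR _ (hτn t ht))).comp t h1
    convert! h2.hasDerivWithinAt using 1
    have h3 := hg.eval_derivative_ne_zero (hηR _ (hτn t ht))
    rw [rescaledField, hg.eval_eq _ (hηR _ (hτn t ht))]
    simp only [hadef, max_eq_left (hτn t ht)]
    rw [← Complex.normSq_eq_norm_sq]
    push_cast
    rw [← Complex.mul_conj]
    field_simp
    simp only [hη, ofReal_exp, ofReal_neg]
    ring
  · have h1 : Tendsto (fun t => η (τ t)) atTop (𝓝 0) := by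
      have h2 : Tendsto (fun t => Real.exp (-τ t)) atTop (𝓝 0) :=
        Real.tendsto_exp_neg_atTop_nhds_zero.comp hτt
      have h3 := ((continuous_ofReal.tendsto 0).comp h2).const_mul w
      simpa [hη] using h3
    have h4 := (hg.continuousAt (mem_ball_self hR)).tendsto.comp h1
    rwa [hg0] at h4

/-! ### Continuation of branches and the radius of convergence -/

theorem isBounded_norm_eval_le {f : ℂ[X]} (hf : 0 < f.degree) (R : ℝ) :
    Bornology.IsBounded {z : ℂ | ‖f.eval z‖ ≤ R} := by
  have h := f.tendsto_norm_atTop hf (l := cocompact ℂ) (z := id) tendsto_norm_cocompact_atTop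
  have h2 := h.eventually (eventually_gt_atTop R)
  rw [← Metric.cobounded_eq_cocompact] at h2
  rw [Bornology.isBounded_def]
  filter_upwards [h2] with z hz
  simpa using hz

theorem _root_.DifferentiableOn.eqOn_of_isPreconnected {u v : ℂ → ℂ} {U : Set ℂ} (hU : IsOpen U)
    (hc : IsPreconnected U) (hu : DifferentiableOn ℂ u U) (hv : DifferentiableOn ℂ v U)
    {z : ℂ} (hz : z ∈ U) (h : u =ᶠ[𝓝 z] v) : EqOn u v U :=
  (hu.analyticOnNhd hU).eqOn_of_preconnected_of_eventuallyEq (hv.analyticOnNhd hU) hc hz h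

/-- Local continuation of a branch across a boundary point of the disk. -/
theorem IsBranchOn.exists_local_extension {f : ℂ[X]} (hf : 0 < f.degree) {g : ℂ → ℂ} {R : ℝ}
    (hR : 0 < R) (hg : IsBranchOn f g (ball 0 R))
    (hcrit : ∀ c ∈ closure (g '' ball 0 R), (derivative f).eval c ≠ 0) {w : ℂ}
    (hw : w ∈ closedBall (0 : ℂ) R) :
    ∃ δ > 0, ∃ h : ℂ → ℂ, DifferentiableOn ℂ h (ball w δ) ∧
      EqOn h g (ball w δ ∩ ball 0 R) := by
  have hbdd : Bornology.IsBounded (g '' ball 0 R) := by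
    refine (isBounded_norm_eval_le hf R).subset ?_
    rintro _ ⟨v, hv, rfl⟩
    have : ‖v‖ < R := by simpa using hv
    simpa [hg.eval_eq v hv] using this.le
  have hcpt : IsCompact (closure (g '' ball 0 R)) := hbdd.isCompact_closure
  have hwc : w ∈ closure (ball (0 : ℂ) R) := by rwa [closure_ball _ hR.ne']
  have hNB : (𝓝[ball 0 R] w).NeBot := mem_closure_iff_nhdsWithin_neBot.1 hwc
  -- A cluster point `c` of `g` at `w` exists by compactness and satisfies `f c = w`. Since `c` is
  -- not critical, the local inverse at `c` provides the extension; it agrees with `g` near some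
  -- point of the disk, hence on the convex intersection.
  obtain ⟨c, hcK, hc⟩ := hcpt.exists_mapClusterPt_of_frequently (l := 𝓝[ball 0 R] w) (f := g)
    (Eventually.frequently (eventually_mem_nhdsWithin.mono fun v hv =>
      subset_closure (mem_image_of_mem g hv)))
  have hfc : f.eval c = w := by
    have h1 : MapClusterPt (f.eval c) (𝓝[ball 0 R] w) ((fun x => f.eval x) ∘ g) :=
      hc.continuousAt_comp f.continuous.continuousAt
    have h2 : Tendsto ((fun x => f.eval x) ∘ g) (𝓝[ball 0 R] w) (𝓝 w) := by
      have : Tendsto id (𝓝[ball 0 R] w) (𝓝 w) := tendsto_id.mono_left nhdsWithin_le_nhds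
      refine this.congr' ?_
      filter_upwards [eventually_mem_nhdsWithin] with v hv
      exact (hg.eval_eq v hv).symm
    have h3 : ClusterPt (f.eval c) (𝓝 w) := h1.clusterPt.mono h2
    exact eq_of_nhds_neBot h3
  obtain ⟨h, -, hl, δ, hδ, hd, -⟩ := exists_local_inverse (hcrit c hcK)
  rw [hfc] at hd
  refine ⟨δ, hδ, h, hd, ?_⟩
  obtain ⟨u, hu1, hu2⟩ := ((hc.frequently hl.eventually_nhds).and_eventually
    (eventually_mem_nhdsWithin.and (mem_nhdsWithin_of_mem_nhds (ball_mem_nhds w hδ)))).exists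
  have hopen : IsOpen (ball w δ ∩ ball (0 : ℂ) R) := isOpen_ball.inter isOpen_ball
  refine DifferentiableOn.eqOn_of_isPreconnected hopen
    ((convex_ball w δ).inter (convex_ball 0 R)).isPreconnected (hd.mono inter_subset_left)
    (hg.differentiableOn.mono inter_subset_right) (z := u) ⟨hu2.2, hu2.1⟩ ?_
  filter_upwards [(hg.continuousAt hu2.1).eventually hu1, hg.isOpen.eventually_mem hu2.1]
    with v hv hv'
  rwa [hg.eval_eq v hv'] at hv

/-- A branch without critical points in the closure of its range extends to a larger disk. -/
theorem IsBranchOn.exists_extension {f : ℂ[X]} (hf : 0 < f.degree) {g : ℂ → ℂ} {R : ℝ}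
    (hR : 0 < R) (hg : IsBranchOn f g (ball 0 R))
    (hcrit : ∀ c ∈ closure (g '' ball 0 R), (derivative f).eval c ≠ 0) :
    ∃ R' > R, ∃ G : ℂ → ℂ, DifferentiableOn ℂ G (ball 0 R') ∧ EqOn G g (ball 0 R) := by
  choose! r hr h hd he using fun w (hw : w ∈ closedBall (0 : ℂ) R) =>
    hg.exists_local_extension hf hR hcrit hw
  obtain ⟨δ, hδ, hleb⟩ := lebesgue_number_lemma_of_metric (isCompact_closedBall (0 : ℂ) R)
    (ι := closedBall (0 : ℂ) R) (c := fun w => ball (w : ℂ) (r w)) (fun _ => isOpen_ball)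
    (fun w hw => mem_iUnion.2 ⟨⟨w, hw⟩, mem_ball_self (hr w hw)⟩)
  have hleb' : ∀ w ∈ closedBall (0 : ℂ) R, ∃ k : ℂ → ℂ, DifferentiableOn ℂ k (ball w δ) ∧
      EqOn k g (ball w δ ∩ ball 0 R) := fun w hw => by
    obtain ⟨i, hi⟩ := hleb w hw
    exact ⟨h i, (hd i i.2).mono hi, (he i i.2).mono (inter_subset_inter_left _ hi)⟩
  choose! k hkd hke using hleb'
  -- The contraction by `q` sends the larger disk into the original one and moves points by less
  -- than `δ/2`. The extension at `w` is read off from the local extension centred at `π w`;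
  -- neighbouring ones agree by the identity theorem.
  set q : ℝ := R / (R + δ / 2) with hq
  have hq0 : 0 < q := by positivity
  have hqR : q * (R + δ / 2) = R := by rw [hq]; field_simp
  set π : ℂ → ℂ := fun w => q * w with hπ
  have hq1 : 0 < 1 - q := by
    rw [hq, sub_pos, div_lt_one (by positivity)]; linarith
  have hπn : ∀ w, ‖π w‖ = q * ‖w‖ := fun w => by
    rw [hπ, norm_mul, norm_real, Real.norm_of_nonneg hq0.le]
  have hπR : ∀ w ∈ ball (0 : ℂ) (R + δ / 2), π w ∈ ball (0 : ℂ) R := fun w hw => by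
    have : ‖w‖ < R + δ / 2 := by simpa using hw
    rw [mem_ball_zero_iff, hπn]
    nlinarith
  have hπd : ∀ w ∈ ball (0 : ℂ) (R + δ / 2), dist w (π w) < δ / 2 := fun w hw => by
    have : ‖w‖ < R + δ / 2 := by simpa using hw
    have e : w - π w = (1 - q : ℝ) * w := by simp only [hπ]; push_cast; ring
    rw [dist_eq_norm, e, norm_mul, norm_real, Real.norm_of_nonneg hq1.le]
    nlinarith
  have hsub : ball (0 : ℂ) R ⊆ closedBall 0 R := ball_subset_closedBall
  have hself : ∀ w ∈ ball (0 : ℂ) (R + δ / 2), w ∈ ball (π w) δ := fun w hw => by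
    rw [mem_ball]; linarith [hπd w hw]
  refine ⟨R + δ / 2, by linarith, fun w => k (π w) w, fun w₀ hw₀ => ?_, fun w hw => ?_⟩
  · have h1 : (fun w => k (π w) w) =ᶠ[𝓝 w₀] k (π w₀) := by
      filter_upwards [isOpen_ball.eventually_mem hw₀,
        ball_mem_nhds w₀ (show 0 < δ / 2 by linarith)] with w hw hww
      have hm1 := hπR w hw
      have hm0 := hπR w₀ hw₀
      have hopen : IsOpen (ball (π w) δ ∩ ball (π w₀) δ) := isOpen_ball.inter isOpen_ball
      have hd1 : dist w (π w₀) < δ := by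
        have := dist_triangle w w₀ (π w₀)
        have h2 := hπd w₀ hw₀
        rw [mem_ball] at hww
        linarith
      have hπw : π w ∈ ball (π w₀) δ := by
        have e : π w - π w₀ = q * (w - w₀) := by simp only [hπ]; ring
        rw [mem_ball, dist_eq_norm] at hww ⊢
        rw [e, norm_mul, norm_real, Real.norm_of_nonneg hq0.le]
        nlinarith [norm_nonneg (w - w₀)]
      refine DifferentiableOn.eqOn_of_isPreconnected hopen
        ((convex_ball _ δ).inter (convex_ball _ δ)).isPreconnected
        ((hkd _ (hsub hm1)).mono inter_subset_left) ((hkd _ (hsub hm0)).mono inter_subset_right)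
        (z := π w) ⟨mem_ball_self hδ, hπw⟩ ?_ ⟨hself w hw, hd1⟩
      filter_upwards [isOpen_ball.eventually_mem hm1,
        isOpen_ball.eventually_mem (mem_ball_self hδ), isOpen_ball.eventually_mem hπw]
        with v h1 h2 h3
      rw [hke _ (hsub hm1) ⟨h2, h1⟩, hke _ (hsub hm0) ⟨h3, h1⟩]
    have h2 : DifferentiableAt ℂ (k (π w₀)) w₀ :=
      (hkd _ (hsub (hπR w₀ hw₀))).differentiableAt (isOpen_ball.mem_nhds (hself w₀ hw₀))
    exact (h2.congr_of_eventuallyEq h1).differentiableWithinAt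
  · have hw' : w ∈ ball (0 : ℂ) (R + δ / 2) := ball_subset_ball (by linarith) hw
    exact hke _ (hsub (hπR w hw')) ⟨hself w hw', hw⟩

/-- The branch of `f⁻¹` at a simple root: its power series has the radius of convergence `R`
equal to the smallest modulus of the critical values of the basin. -/
theorem exists_branch {f : ℂ[X]} (hdeg : ∃ c, (derivative f).eval c = 0) {ζ : ℂ}
    (hζ : f.eval ζ = 0) (hζ' : (derivative f).eval ζ ≠ 0) :
    ∃ (p : FormalMultilinearSeries ℂ ℂ ℂ) (g : ℂ → ℂ) (R : ℝ), 0 < R ∧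
      IsInverseBranchSeries f ζ p ∧ p.radius = ENNReal.ofReal R ∧
      IsLeast (criticalModuli f ζ) R ∧ IsBranchOn f g (ball 0 R) ∧ g 0 = ζ ∧
      ∀ z ∈ basin f ζ, ‖f.eval z‖ < R → g (f.eval z) = z := by
  have hf : 0 < f.degree := by
    by_contra h
    rw [not_lt] at h
    rw [eq_C_of_degree_le_zero h, derivative_C, eval_zero] at hζ'
    exact hζ' rfl
  obtain ⟨h, hh0, -, δ, hδ, hd, hinv⟩ := exists_local_inverse hζ'
  rw [hζ] at hh0 hd hinv
  obtain ⟨p, hp⟩ := (hd.analyticAt (ball_mem_nhds 0 hδ))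
  have hball := p.hasFPowerSeriesOnBall hp.radius_pos
  set g := p.sum
  have hhg : h =ᶠ[𝓝 0] g := by
    obtain ⟨r, hr⟩ := hp
    filter_upwards [Metric.eball_mem_nhds (0 : ℂ) hr.r_pos] with w hw
    have := hr.sum hw
    simpa using this
  have hg0 : g 0 = ζ := by rw [← hhg.self_of_nhds, hh0]
  have hgf : ∀ᶠ w in 𝓝 (0 : ℂ), f.eval (g w) = w := by
    filter_upwards [hhg, ball_mem_nhds (0 : ℂ) hδ] with w h1 h2
    rw [← h1, hinv w h2]
  have hgd : DifferentiableOn ℂ g (Metric.eball 0 p.radius) := hball.differentiableOn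
  have hbranch : ∀ r : ℝ, ENNReal.ofReal r ≤ p.radius → IsBranchOn f g (ball 0 r) := fun r hr => by
    rcases le_or_gt r 0 with h0 | h0
    · rw [ball_eq_empty.2 h0]
      exact ⟨isOpen_empty, differentiableOn_empty, fun w hw => absurd hw (notMem_empty w)⟩
    have hsub : ball (0 : ℂ) r ⊆ Metric.eball 0 p.radius := by
      rw [← Metric.eball_ofReal]; exact Metric.eball_subset_eball hr
    refine ⟨isOpen_ball, hgd.mono hsub, ?_⟩
    exact DifferentiableOn.eqOn_of_isPreconnected isOpen_ball (convex_ball 0 r).isPreconnected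
      (f.differentiable.comp_differentiableOn (hgd.mono hsub)) differentiableOn_id
      (mem_ball_self h0) hgf
  have hseries : IsInverseBranchSeries f ζ p := ⟨g, hball.hasFPowerSeriesAt, hg0, hgf⟩
  -- If `g` were entire, `g ∘ f` would be the identity on a nonempty clopen set, hence everywhere,
  -- and `f` would have no critical point.
  have htop : p.radius ≠ ⊤ := fun htop => by
    have hb : IsBranchOn f g univ := by
      refine ⟨isOpen_univ, ?_, fun w _ => ?_⟩
      · have := hgd
        rwa [htop, Metric.eball_top] at this
      · exact (hbranch (‖w‖ + 1) (by simp [htop])).eval_eq w (by simp)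
    have hcl : IsClopen {x | g (f.eval x) = x} := by
      constructor
      · refine isClosed_eq ?_ continuous_id
        exact (continuous_iff_continuousAt.2 fun w => hb.continuousAt (mem_univ w)).comp
          f.continuous
      · refine isOpen_iff_mem_nhds.2 fun x hx => ?_
        have h1 := hb.eventually_apply_eval (mem_univ (f.eval x))
        rwa [show g (f.eval x) = x from hx] at h1
    have huniv := hcl.eq_univ ⟨ζ, by simp [hζ, hg0]⟩
    obtain ⟨c, hc⟩ := hdeg
    have h1 : c ∈ {x | g (f.eval x) = x} := huniv ▸ mem_univ c
    have h2 := hb.eval_derivative_ne_zero (mem_univ (f.eval c))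
    rw [show g (f.eval c) = c from h1] at h2
    exact h2 hc
  set R := p.radius.toReal
  have hRrad : p.radius = ENNReal.ofReal R := (ENNReal.ofReal_toReal htop).symm
  have hR : 0 < R := ENNReal.toReal_pos hp.radius_pos.ne' htop
  have hb := hbranch R hRrad.ge
  have hbasin : ∀ z ∈ basin f ζ, ‖f.eval z‖ < R → g (f.eval z) = z := fun z hz hzR =>
    apply_eval_of_mem_basin hb hR hg0 hz hzR
  -- If `|f c| < R`, then `g (f z) = z` passes from basin points to their limit `c`, but `f'` does
  -- not vanish on the range of `g`.
  have hlower : ∀ c ∈ criticalPoints f ζ, R ≤ ‖f.eval c‖ := by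
    rintro c ⟨hc, hcl⟩
    by_contra! hlt
    have hNB : (𝓝[basin f ζ] c).NeBot := mem_closure_iff_nhdsWithin_neBot.1 hcl
    have hcR : f.eval c ∈ ball (0 : ℂ) R := by simpa using hlt
    have h1 : Tendsto (fun z => g (f.eval z)) (𝓝[basin f ζ] c) (𝓝 (g (f.eval c))) :=
      ((hb.continuousAt hcR).comp (f := fun z => f.eval z)
        f.continuous.continuousAt).tendsto.mono_left nhdsWithin_le_nhds
    have h2 : Tendsto id (𝓝[basin f ζ] c) (𝓝 c) := tendsto_id.mono_left nhdsWithin_le_nhds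
    have h3 : (fun z => g (f.eval z)) =ᶠ[𝓝[basin f ζ] c] id := by
      filter_upwards [eventually_mem_nhdsWithin, mem_nhdsWithin_of_mem_nhds
        (f.continuous.norm.continuousAt.eventually (gt_mem_nhds hlt))] with z hz hz'
      exact hbasin z hz hz'
    have h4 := tendsto_nhds_unique (h2.congr' h3.symm) h1
    have h5 := hb.eval_derivative_ne_zero hcR
    rw [← h4] at h5
    exact h5 hc
  have hexists : ∃ c ∈ closure (g '' ball 0 R), (derivative f).eval c = 0 := by
    by_contra! hcrit
    obtain ⟨R', hR', G, hGd, hGg⟩ := hb.exists_extension hf hR hcrit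
    obtain ⟨r, hr1, hr2⟩ := exists_between hR'
    lift r to NNReal using (hR.trans hr1).le
    have hG := (hGd.mono (closedBall_subset_ball hr2)).hasFPowerSeriesOnBall
      (by exact_mod_cast hR.trans hr1)
    have hGg' : G =ᶠ[𝓝 0] g := by
      filter_upwards [ball_mem_nhds (0 : ℂ) hR] with w hw using hGg hw
    have e := (hG.hasFPowerSeriesAt.congr hGg').eq_formalMultilinearSeries hball.hasFPowerSeriesAt
    have h1 := hG.r_le
    rw [e, hRrad] at h1
    have h2 : ENNReal.ofReal r ≤ ENNReal.ofReal R := by simpa using h1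
    rw [ENNReal.ofReal_le_ofReal_iff hR.le] at h2
    linarith
  refine ⟨p, g, R, hR, hseries, hRrad, ⟨?_, ?_⟩, hb, hg0, hbasin⟩
  · obtain ⟨c, hc, hc'⟩ := hexists
    have hcb : c ∈ criticalPoints f ζ := ⟨hc', closure_mono (by
      rintro _ ⟨w, hw, rfl⟩; exact hb.mem_basin hg0 hw) hc⟩
    refine ⟨c, hcb, le_antisymm ?_ (hlower c hcb)⟩
    have h1 : IsClosed {z : ℂ | ‖f.eval z‖ ≤ R} :=
      isClosed_le f.continuous.norm continuous_const
    refine closure_minimal ?_ h1 hc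
    rintro _ ⟨w, hw, rfl⟩
    have : ‖w‖ < R := by simpa using hw
    simpa [hb.eval_eq w hw] using this.le
  · rintro _ ⟨c, hc, rfl⟩
    exact hlower c hc

/-! ### Polynomial estimates outside the unit disk -/

/-- The bound is the value at the extremal boundary point `a = -z/|z|`, excluded by `|a| < 1`. -/
theorem lt_re_div_sub {z a : ℂ} (hz : 1 ≤ ‖z‖) (ha : ‖a‖ < 1) :
    ‖z‖ / (‖z‖ + 1) < (z / (z - a)).re := by
  have hne : z - a ≠ 0 := fun h => by
    rw [sub_eq_zero.1 h] at hz; linarith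
  have hpos : 0 < normSq (z - a) := normSq_pos.2 hne
  have e : (z / (z - a)).re = (normSq z - (z * (starRingEnd ℂ) a).re) / normSq (z - a) := by
    rw [Complex.div_re, ← add_div]
    congr 1
    simp only [normSq_apply, sub_re, sub_im, mul_re, conj_re, conj_im]
    ring
  have e2 : normSq (z - a) = ‖z‖ ^ 2 - 2 * (z * (starRingEnd ℂ) a).re + ‖a‖ ^ 2 := by
    rw [← normSq_eq_norm_sq, ← normSq_eq_norm_sq, normSq_sub]
    ring
  have hx : -(‖z‖ * ‖a‖) ≤ (z * (starRingEnd ℂ) a).re := by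
    have := neg_abs_le (z * (starRingEnd ℂ) a).re
    have h2 := abs_re_le_norm (z * (starRingEnd ℂ) a)
    rw [norm_mul, norm_conj] at h2
    linarith
  rw [e, div_lt_div_iff₀ (by positivity) hpos, e2, normSq_eq_norm_sq]
  set n := ‖z‖
  set m := ‖a‖
  set x := (z * (starRingEnd ℂ) a).re
  have hm : 0 ≤ m := norm_nonneg a
  have h1 : x * (n - 1) ≥ -(n * m) * (n - 1) := mul_le_mul_of_nonneg_right hx (by linarith)
  have h2 : 0 < n * ((1 - m) * (m + n)) :=
    mul_pos (by linarith) (mul_pos (by linarith) (by linarith))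
  nlinarith

namespace MemPd

variable {d : ℕ} {f : ℂ[X]}

theorem re_mul_derivative_div (hf : MemPd d f) (hd : 0 < d) {z : ℂ} (hz : 1 ≤ ‖z‖) :
    d * (‖z‖ / (‖z‖ + 1)) < (z * (derivative f).eval z / f.eval z).re := by
  obtain ⟨ζ, -, hζ, rfl⟩ := hf
  have hne : ∀ j, z - ζ j ≠ 0 := fun j h => by
    have := hζ j
    rw [← sub_eq_zero.1 h] at this; linarith
  have e : z * (derivative (∏ j, (X - C (ζ j)))).eval z / (∏ j, (X - C (ζ j))).eval z =
      ∑ j, z / (z - ζ j) := by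
    rw [derivative_prod_finset, eval_finsetSum, Finset.mul_sum, Finset.sum_div]
    refine Finset.sum_congr rfl fun j _ => ?_
    rw [← Finset.mul_prod_erase Finset.univ (fun j => X - C (ζ j)) (Finset.mem_univ j)]
    have h1 : (∏ i ∈ Finset.univ.erase j, (X - C (ζ i))).eval z ≠ 0 := by
      rw [eval_prod, Finset.prod_ne_zero_iff]
      intro i _
      simpa using hne i
    have h2 := hne j
    simp only [eval_mul, eval_sub, eval_X, eval_C, derivative_sub, derivative_X, derivative_C,
      sub_zero, mul_one]
    field_simp
  rw [e, re_sum]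
  have : (d : ℝ) * (‖z‖ / (‖z‖ + 1)) = ∑ _j : Fin d, ‖z‖ / (‖z‖ + 1) := by simp
  rw [this]
  have : Nonempty (Fin d) := ⟨⟨0, hd⟩⟩
  exact Finset.sum_lt_sum_of_nonempty Finset.univ_nonempty fun j _ => lt_re_div_sub hz (hζ j)

theorem norm_root_lt (hf : MemPd d f) {z : ℂ} (hz : f.eval z = 0) : ‖z‖ < 1 := by
  obtain ⟨ζ, -, hζ, rfl⟩ := hf
  rw [eval_prod, Finset.prod_eq_zero_iff] at hz
  obtain ⟨j, -, hj⟩ := hz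
  rw [show z = ζ j by simpa [sub_eq_zero] using hj]
  exact hζ j

theorem eval_ne_zero (hf : MemPd d f) {z : ℂ} (hz : 1 ≤ ‖z‖) : f.eval z ≠ 0 := fun h =>
  absurd (hf.norm_root_lt h) (not_lt.2 hz)

theorem derivative_ne_zero (hf : MemPd d f) (hd : 0 < d) {z : ℂ} (hz : 1 ≤ ‖z‖) :
    (derivative f).eval z ≠ 0 := fun h => by
  have h1 := hf.re_mul_derivative_div hd hz
  rw [h] at h1
  simp only [mul_zero, zero_div, zero_re] at h1
  have : 0 ≤ d * (‖z‖ / (‖z‖ + 1)) := by positivity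
  linarith

/-- Bounds the speed of the preimage of a ray, parametrized by the logarithm of the value's modulus.
-/
theorem norm_eval_div_derivative_lt (hf : MemPd d f) (hd : 0 < d) {z : ℂ} (hz : 1 ≤ ‖z‖) :
    ‖f.eval z / (derivative f).eval z‖ < (1 + ‖z‖) / d := by
  have h1 := (hf.re_mul_derivative_div hd hz).trans_le (re_le_norm _)
  have h2 := norm_pos_iff.2 (hf.eval_ne_zero hz)
  have h3 := norm_pos_iff.2 (hf.derivative_ne_zero hd hz)
  have hd' : (0 : ℝ) < d := by exact_mod_cast hd
  rw [norm_div, norm_mul, mul_div_assoc', div_lt_div_iff₀ (by linarith) h2] at h1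
  rw [norm_div, div_lt_div_iff₀ h3 hd']
  refine lt_of_mul_lt_mul_left ?_ (norm_nonneg z)
  linarith

theorem re_conj_mul_eval_div_derivative_pos (hf : MemPd d f) (hd : 0 < d) {z : ℂ}
    (hz : 1 ≤ ‖z‖) : 0 < ((starRingEnd ℂ) z * (f.eval z / (derivative f).eval z)).re := by
  have h1 := hf.re_mul_derivative_div hd hz
  have h2 : 0 < (z * (derivative f).eval z / f.eval z).re :=
    lt_of_le_of_lt (by positivity) h1
  have hz0 : z ≠ 0 := norm_pos_iff.1 (by linarith)
  have h3 := hf.eval_ne_zero hz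
  have h4 := hf.derivative_ne_zero hd hz
  have e : (starRingEnd ℂ) z * (f.eval z / (derivative f).eval z) =
      (normSq z : ℝ) * (z * (derivative f).eval z / f.eval z)⁻¹ := by
    rw [← Complex.mul_conj]
    field_simp
  rw [e, re_ofReal_mul, inv_re]
  have h5 : z * (derivative f).eval z / f.eval z ≠ 0 := by positivity
  exact mul_pos (normSq_pos.2 hz0) (div_pos h2 (normSq_pos.2 h5))

theorem pow_le_norm_eval (hf : MemPd d f) {z : ℂ} (hz : 1 ≤ ‖z‖) :
    (‖z‖ - 1) ^ d ≤ ‖f.eval z‖ := by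
  obtain ⟨ζ, -, hζ, rfl⟩ := hf
  rw [eval_prod, norm_prod]
  have : (‖z‖ - 1) ^ d = ∏ _j : Fin d, (‖z‖ - 1) := by simp
  rw [this]
  refine Finset.prod_le_prod (fun _ _ => by linarith) fun j _ => ?_
  simp only [eval_sub, eval_X, eval_C]
  have := norm_sub_norm_le z (ζ j)
  linarith [hζ j]

theorem norm_eval_le_two_pow (hf : MemPd d f) {z : ℂ} (hz : ‖z‖ ≤ 1) :
    ‖f.eval z‖ ≤ 2 ^ d := by
  obtain ⟨ζ, -, hζ, rfl⟩ := hf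
  rw [eval_prod, norm_prod]
  have : (2 : ℝ) ^ d = ∏ _j : Fin d, (2 : ℝ) := by simp
  rw [this]
  refine Finset.prod_le_prod (fun _ _ => norm_nonneg _) fun j _ => ?_
  simp only [eval_sub, eval_X, eval_C]
  have := norm_sub_le z (ζ j)
  linarith [hζ j]

theorem derivative_ne_zero_of_root (hf : MemPd d f) {ζ : ℂ} (h : f.eval ζ = 0) :
    (derivative f).eval ζ ≠ 0 := by
  obtain ⟨a, ha, -, rfl⟩ := hf
  have hs : (∏ j, (X - C (a j))).Separable := separable_prod_X_sub_C_iff.2 ha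
  have := hs.eval₂_derivative_ne_zero (RingHom.id ℂ) (x := ζ) (by simpa [eval₂_id] using h)
  simpa [eval₂_id] using this

theorem exists_derivative_root (hf : MemPd d f) (hd : 2 ≤ d) :
    ∃ c, (derivative f).eval c = 0 := by
  have hdeg : f.natDegree = d := by
    obtain ⟨ζ, -, -, rfl⟩ := hf
    rw [natDegree_prod_of_monic _ _ fun j _ => monic_X_sub_C _]
    simp
  refine IsAlgClosed.exists_root (derivative f) ?_
  have h1 : (derivative f).natDegree = f.natDegree - 1 := natDegree_derivative f
  intro h0
  have := natDegree_eq_zero_iff_degree_le_zero.2 h0.le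
  omega

end MemPd

/-! ### Preimages of rays -/

/-- A function which increases wherever it is at least `m` stays above its initial value. -/
theorem lt_of_deriv_pos_of_le {u u' : ℝ → ℝ} {a b m : ℝ} (hab : a < b) (hm : m ≤ u a)
    (hu : ∀ t ∈ Icc a b, HasDerivAt u (u' t) t) (hpos : ∀ t ∈ Icc a b, m ≤ u t → 0 < u' t) :
    u a < u b := by
  have hle : ∀ ⦃t⦄, t ∈ Icc a b → u a ≤ u t :=
    image_le_of_deriv_right_lt_deriv_boundary' (f := fun _ => u a) (f' := 0)
      continuousOn_const (fun t _ => hasDerivWithinAt_const t _ (u a)) le_rfl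
      (fun t ht => (hu t ht).continuousAt.continuousWithinAt)
      (fun t ht => (hu t (Ico_subset_Icc_self ht)).hasDerivWithinAt)
      (fun t ht h => hpos t (Ico_subset_Icc_self ht) (hm.trans_eq h))
  refine strictMonoOn_of_deriv_pos (convex_Icc a b)
    (fun t ht => (hu t ht).continuousAt.continuousWithinAt) (fun t ht => ?_)
    (left_mem_Icc.2 hab.le) (right_mem_Icc.2 hab.le) hab
  have ht' := interior_subset ht
  rw [(hu t ht').deriv]
  exact hpos t ht' (hm.trans (hle ht'))

variable {d : ℕ} {f : ℂ[X]} {g : ℂ → ℂ} {R : ℝ}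

theorem ray_mem_ball {e : ℂ} (he : ‖e‖ = 1) {t : ℝ} (ht : 0 ≤ t) (htR : t < R) :
    (t : ℂ) * e ∈ ball (0 : ℂ) R := by
  simpa [he, abs_of_nonneg ht] using htR

theorem IsBranchOn.hasDerivAt_ray (hg : IsBranchOn f g (ball 0 R)) {e : ℂ} (he : ‖e‖ = 1) {t : ℝ}
    (ht : 0 < t) (htR : t < R) :
    HasDerivAt (fun t : ℝ => g (t * e))
      ((t⁻¹ : ℝ) * (f.eval (g (t * e)) / (derivative f).eval (g (t * e)))) t := by
  have hm := ray_mem_ball he ht.le htR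
  have h1 : HasDerivAt (fun t : ℝ => (t : ℂ) * e) (1 * e) t :=
    (hasDerivAt_id t).ofReal_comp.mul_const e
  have h2 := (hg.hasDerivAt hm).comp t h1
  convert! h2 using 1
  have h3 := hg.eval_derivative_ne_zero hm
  have h4 : (t : ℂ) ≠ 0 := by exact_mod_cast ht.ne'
  rw [hg.eval_eq _ hm]
  push_cast
  field_simp

/-- Outside the unit disk the modulus increases along the preimage of a ray. -/
theorem IsBranchOn.norm_ray_lt (hf : MemPd d f) (hd : 0 < d) (hg : IsBranchOn f g (ball 0 R))
    {e : ℂ} (he : ‖e‖ = 1) {s t : ℝ} (hs : 0 < s) (hst : s < t) (htR : t < R)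
    (h1 : 1 ≤ ‖g (s * e)‖) : ‖g (s * e)‖ < ‖g (t * e)‖ := by
  refine lt_of_pow_lt_pow_left₀ 2 (norm_nonneg _) ?_
  refine lt_of_deriv_pos_of_le (u := fun t : ℝ => ‖g (t * e)‖ ^ 2) hst (one_le_pow₀ h1)
    (fun v hv => (hg.hasDerivAt_ray he (hs.trans_le hv.1) (hv.2.trans_lt htR)).norm_sq)
    fun v hv hv1 => ?_
  have hv0 := hs.trans_le hv.1
  have hv1 : 1 ≤ ‖g (v * e)‖ := by
    rwa [one_le_sq_iff₀ (norm_nonneg _)] at hv1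
  have h2 := hf.re_conj_mul_eval_div_derivative_pos hd hv1
  change 0 < 2 * inner ℝ (g (v * e)) ((v⁻¹ : ℝ) * (f.eval (g (v * e)) /
    (derivative f).eval (g (v * e))))
  rw [← Complex.real_smul (x := v⁻¹), real_inner_smul_right, Complex.inner, mul_comm _ ((starRingEnd ℂ) _)]
  exact mul_pos two_pos (mul_pos (inv_pos.2 hv0) h2)

/-- Growth of the modulus along the preimage of a ray outside the unit disk. -/
theorem IsBranchOn.norm_ray_pow_le (hf : MemPd d f) (hd : 0 < d)
    (hg : IsBranchOn f g (ball 0 R)) {e : ℂ} (he : ‖e‖ = 1) {s t : ℝ} (hs : 0 < s) (hst : s ≤ t)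
    (htR : t < R) (h1 : 1 ≤ ‖g (s * e)‖) :
    (1 + ‖g (t * e)‖) ^ d ≤ (1 + ‖g (s * e)‖) ^ d * (t / s) := by
  have hd' : (0 : ℝ) < d := by exact_mod_cast hd
  set A := 1 + ‖g (s * e)‖ with hA
  set B : ℝ → ℝ := fun v => A * Real.exp ((Real.log v - Real.log s) / d) - 1 with hB
  have hBd : ∀ v, 0 < v → HasDerivAt B ((1 + B v) / (d * v)) v := fun v hv => by
    have h := (((((Real.hasDerivAt_log hv.ne').sub_const (Real.log s)).div_const
      (d : ℝ)).exp).const_mul A).sub_const 1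
    convert! h using 1
    simp only [hB]
    field_simp
    ring
  have hBge : ∀ v, s ≤ v → 1 ≤ B v := fun v hv => by
    have h2 : 1 ≤ Real.exp ((Real.log v - Real.log s) / d) := by
      rw [Real.one_le_exp_iff]
      exact div_nonneg (sub_nonneg.2 (Real.log_le_log hs hv)) hd'.le
    simp only [hB]
    nlinarith
  -- `B` solves `B' = (1 + B) / (d v)` with `B s = |g (s e)|`, the equality case of the bound on
  -- `|f/f'|`. It stays at least `1`, so that bound applies at any contact.
  have key := image_norm_le_of_norm_deriv_right_lt_deriv_boundary' (a := s) (b := t)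
    (f := fun v : ℝ => g (v * e))
    (fun v hv => (hg.hasDerivAt_ray he (hs.trans_le hv.1)
      (hv.2.trans_lt htR)).continuousAt.continuousWithinAt)
    (fun v hv => (hg.hasDerivAt_ray he (hs.trans_le hv.1) (hv.2.trans htR)).hasDerivWithinAt)
    (B := B) (by simp [hB, hA])
    (fun v hv => (hBd v (hs.trans_le hv.1)).continuousAt.continuousWithinAt)
    (fun v hv => (hBd v (hs.trans_le hv.1)).hasDerivWithinAt)
    (fun v hv hve => by
      have hv0 := hs.trans_le hv.1
      have h2 := hf.norm_eval_div_derivative_lt hd (z := g (v * e)) (by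
        rw [hve]; exact hBge v hv.1)
      rw [hve] at h2
      rw [norm_mul, norm_real, Real.norm_of_nonneg (inv_pos.2 hv0).le]
      calc v⁻¹ * _ < v⁻¹ * ((1 + B v) / d) := mul_lt_mul_of_pos_left h2 (inv_pos.2 hv0)
        _ = _ := by field_simp)
    (right_mem_Icc.2 hst)
  have ht0 := hs.trans_le hst
  have h3 : 1 + ‖g (t * e)‖ ≤ A * Real.exp ((Real.log t - Real.log s) / d) := by
    simp only [hB] at key; linarith
  calc (1 + ‖g (t * e)‖) ^ d ≤ (A * Real.exp ((Real.log t - Real.log s) / d)) ^ d := by gcongr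
    _ = A ^ d * (t / s) := by
      rw [mul_pow, ← Real.exp_nat_mul, mul_div_cancel₀ _ hd'.ne', ← Real.log_div ht0.ne' hs.ne',
        Real.exp_log (by positivity)]

/-- The image of an inverse branch contains no large disk centred on the unit circle. -/
theorem IsBranchOn.radius_le_of_ball_subset (hf : MemPd d f) (hd : 2 ≤ d)
    (hg : IsBranchOn f g (ball 0 R)) {z₁ : ℂ} (hz₁ : ‖z₁‖ = 1) {a : ℝ}
    (ha : ball z₁ a ⊆ g '' ball 0 R) : a ≤ 2 * Real.pi / d := by
  by_contra! hlt
  have hd0 : 0 < d := by omega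
  have hd' : (2 : ℝ) ≤ d := by exact_mod_cast hd
  have hπ := Real.pi_pos
  set α := 2 * Real.pi / d with hα
  have hα0 : 0 < α := by positivity
  have hαπ : α ≤ Real.pi := by
    rw [hα, div_le_iff₀ (by linarith)]; nlinarith
  set c : ℝ → ℂ := fun θ => z₁ * exp (I * θ) with hc
  have hcn : ∀ θ, ‖c θ‖ = 1 := fun θ => by
    rw [hc, norm_mul, hz₁, mul_comm I, norm_exp_ofReal_mul_I, one_mul]
  have hcd : ∀ θ, HasDerivAt c (I * c θ) θ := fun θ => by
    have h := ((((hasDerivAt_id θ).ofReal_comp).const_mul I).cexp).const_mul z₁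
    convert! h using 1
    simp only [hc, id, ofReal_one]
    ring
  have hcc : Continuous c := continuous_iff_continuousAt.2 fun θ => (hcd θ).continuousAt
  have hfc : ∀ θ, f.eval (c θ) ≠ 0 := fun θ => hf.eval_ne_zero (hcn θ).ge
  set l : ℝ → ℂ := fun θ => I * (c θ * (derivative f).eval (c θ) / f.eval (c θ)) with hl
  have hlc : Continuous l := continuous_const.mul
    ((hcc.mul ((derivative f).continuous.comp hcc)).div (f.continuous.comp hcc) hfc)
  -- A continuous logarithm of `f (c θ) / f (c (-α))`; its imaginary part grows faster than `d/2`,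
  -- so by more than `2π` over length `2α = 4π/d`.
  set L : ℝ → ℂ := fun θ => ∫ x in (-α)..θ, l x with hL
  have hLd : ∀ θ, HasDerivAt L (l θ) θ := fun θ =>
    intervalIntegral.integral_hasDerivAt_right (hlc.intervalIntegrable _ _)
      (hlc.stronglyMeasurableAtFilter _ _) hlc.continuousAt
  have hL0 : L (-α) = 0 := by simp [hL]
  have hexp : ∀ θ, f.eval (c θ) = f.eval (c (-α)) * exp (L θ) := fun θ => by
    have h1 : ∀ θ, HasDerivAt (fun θ => f.eval (c θ) * exp (-L θ)) 0 θ := fun θ => by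
      have h2 := ((f.hasDerivAt (c θ)).comp θ (hcd θ)).mul (hLd θ).neg.cexp
      convert! h2 using 1
      have := hfc θ
      simp only [hl, Function.comp_apply]
      field_simp
      ring
    have h3 := is_const_of_deriv_eq_zero (fun θ => (h1 θ).differentiableAt)
      (fun θ => (h1 θ).deriv) θ (-α)
    simp only [hL0, neg_zero, exp_zero, mul_one] at h3
    rw [← h3, mul_assoc, ← exp_add, neg_add_cancel, exp_zero, mul_one]
  have hIm : ∀ θ, HasDerivAt (fun θ => (L θ).im) (l θ).im θ := fun θ =>
    imCLM.hasFDerivAt.comp_hasDerivAt θ (hLd θ)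
  have hIml : ∀ θ, (d : ℝ) / 2 < (l θ).im := fun θ => by
    have h1 := hf.re_mul_derivative_div hd0 (hcn θ).ge
    rw [hcn θ] at h1
    simp only [hl, I_mul_im]
    linarith
  have hIm2 : 2 * Real.pi < (L α).im := by
    have h1 : StrictMono fun θ => (L θ).im - d / 2 * θ := strictMono_of_deriv_pos fun θ => by
      have h2 : deriv (fun θ => (L θ).im - d / 2 * θ) θ = (l θ).im - d / 2 * 1 :=
        ((hIm θ).sub ((hasDerivAt_id θ).const_mul ((d : ℝ) / 2))).deriv
      rw [h2]
      linarith [hIml θ]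
    have h3 := h1 (show -α < α by linarith)
    simp only [hL0, zero_im] at h3
    have h4 : d / 2 * α = Real.pi := by rw [hα]; field_simp
    linarith
  obtain ⟨β, hβ, hβ2⟩ := intermediate_value_Ioo (show -α ≤ α by linarith)
    (fun θ _ => (hIm θ).continuousAt.continuousWithinAt) (show 2 * Real.pi ∈ Ioo _ _ from
      ⟨by simp only [hL0, zero_im]; linarith, hIm2⟩)
  have hmem : ∀ θ, |θ| ≤ α → c θ ∈ g '' ball 0 R := fun θ hθ => by
    refine ha ?_
    have e : c θ - z₁ = z₁ * (exp (I * θ) - 1) := by simp only [hc]; ring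
    rw [mem_ball, dist_eq_norm, e, norm_mul, hz₁, one_mul]
    exact (Real.norm_exp_I_mul_ofReal_sub_one_le (x := θ)).trans_lt (hθ.trans_lt hlt)
  obtain ⟨w, hw, hwc⟩ := hmem (-α) (by rw [abs_neg, abs_of_pos hα0])
  obtain ⟨v, hv, hvc⟩ := hmem β (abs_le.2 ⟨hβ.1.le, hβ.2.le⟩)
  have hw' : f.eval (c (-α)) = w := by rw [← hwc, hg.eval_eq w hw]
  have hv' : f.eval (c β) = v := by rw [← hvc, hg.eval_eq v hv]
  have hw0 : w ≠ 0 := hw' ▸ hfc _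
  set κ := Real.exp (L β).re with hκ
  have hκ0 : 0 < κ := Real.exp_pos _
  have hvw : v = κ * w := by
    rw [← hv', hexp β, hw', mul_comm]
    congr 1
    rw [← re_add_im (L β), (show (L β).im = 2 * Real.pi from hβ2), exp_add, hκ, ofReal_exp]
    have : (((2 * Real.pi : ℝ) : ℂ) * I) = 2 * Real.pi * I := by push_cast; ring
    rw [this, exp_two_pi_mul_I, mul_one]
  set e : ℂ := w / ‖w‖ with he
  have hwn : 0 < ‖w‖ := norm_pos_iff.2 hw0
  have he1 : ‖e‖ = 1 := by
    rw [he, norm_div, norm_real, norm_norm, div_self hwn.ne']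
  have hwe : w = (‖w‖ : ℝ) * e := by
    rw [he]
    have : (‖w‖ : ℂ) ≠ 0 := by exact_mod_cast hwn.ne'
    field_simp
  have hve : v = ((κ * ‖w‖ : ℝ) : ℂ) * e := by
    rw [hvw]; push_cast
    rw [mul_assoc, ← hwe]
  have hwR : ‖w‖ < R := by simpa using hw
  have hvR : κ * ‖w‖ < R := by
    have : ‖v‖ < R := by simpa using hv
    rwa [hvw, norm_mul, norm_real, Real.norm_of_nonneg hκ0.le] at this
  have hgw : ‖g ((‖w‖ : ℝ) * e)‖ = 1 := by rw [← hwe, hwc, hcn]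
  have hgv : ‖g ((κ * ‖w‖ : ℝ) * e)‖ = 1 := by rw [← hve, hvc, hcn]
  -- For `κ ≠ 1` two points of modulus `1` lie on the preimage of one ray, against strict growth.
  -- For `κ = 1` the points coincide, impossible for angles differing by less than `2α ≤ 2π`; this
  -- needs `d ≥ 2`.
  rcases lt_trichotomy κ 1 with h | h | h
  · have := hg.norm_ray_lt hf hd0 he1 (show 0 < κ * ‖w‖ by positivity)
      (show κ * ‖w‖ < ‖w‖ by nlinarith) hwR hgv.ge
    linarith
  · have hcc' : c (-α) = c β := by
      rw [← hwc, ← hvc, hvw, h, ofReal_one, one_mul]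
    have hz0 : z₁ ≠ 0 := norm_pos_iff.1 (by linarith)
    have h1 : exp (I * (-α : ℝ)) = exp (I * β) := mul_left_cancel₀ hz0 hcc'
    rw [exp_eq_exp_iff_exists_int] at h1
    obtain ⟨n, hn⟩ := h1
    have h2 : ((-α : ℝ) : ℂ) = ((β + n * (2 * Real.pi) : ℝ) : ℂ) := by
      apply mul_left_cancel₀ I_ne_zero
      rw [hn]; push_cast; ring
    have h3 : -α = β + n * (2 * Real.pi) := by exact_mod_cast h2
    have h4 : (-1 : ℝ) < n := by nlinarith [hβ.1, hβ.2]
    have h5 : (n : ℝ) < 0 := by nlinarith [hβ.1, hβ.2]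
    have h6 : (-1 : ℤ) < n := by exact_mod_cast h4
    have h7 : n < 0 := by exact_mod_cast h5
    omega
  · have := hg.norm_ray_lt hf hd0 he1 hwn (show ‖w‖ < κ * ‖w‖ by nlinarith) hvR hgw.ge
    linarith

/-! ### Distortion estimates -/

/-- The preimage of a ray crosses the unit circle before leaving the unit disk. -/
theorem IsBranchOn.exists_norm_ray_eq_one (hg : IsBranchOn f g (ball 0 R)) {e : ℂ}
    (he : ‖e‖ = 1) {s t : ℝ} (hs0 : 0 ≤ s) (hst : s ≤ t) (htR : t < R)
    (hs : ‖g (s * e)‖ < 1) (ht : 1 < ‖g (t * e)‖) : ∃ v ∈ Ioo s t, ‖g (v * e)‖ = 1 := by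
  have hc : ContinuousOn (fun v : ℝ => ‖g (v * e)‖) (Icc s t) := by
    refine (hg.differentiableOn.continuousOn.comp (by fun_prop) fun v hv => ?_).norm
    exact ray_mem_ball he (hs0.trans hv.1) (hv.2.trans_lt htR)
  obtain ⟨v, hv, hv1⟩ := intermediate_value_Ioo hst hc (show (1 : ℝ) ∈ Ioo _ _ from ⟨hs, ht⟩)
  exact ⟨v, hv, hv1⟩

theorem koebe_function_mono {x y : ℝ} (hx : 0 ≤ x) (hxy : x ≤ y) (hy : y < 1) :
    x / (1 - x) ^ 2 ≤ y / (1 - y) ^ 2 := by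
  have h1 : 0 < 1 - y := by linarith
  have h2 : 1 - y ≤ 1 - x := by linarith
  have h3 : 0 ≤ y := hx.trans hxy
  gcongr

/-- The main distortion estimate: how far the image of a small disk leaves the unit disk. -/
theorem IsBranchOn.norm_ray_sub_one_le (hf : MemPd d f) (hd : 2 ≤ d)
    (hg : IsBranchOn f g (ball 0 R)) (hg0 : ‖g 0‖ < 1) {e : ℂ} (he : ‖e‖ = 1) {t : ℝ}
    (ht0 : 0 ≤ t) (htR : t < R) :
    ‖g (t * e)‖ - 1 ≤ 8 * Real.pi / d * (t / R / (1 - t / R) ^ 2) := by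
  have hR : 0 < R := ht0.trans_lt htR
  have htR1 : t / R < 1 := (div_lt_one hR).2 htR
  have hπ := Real.pi_pos
  set k := t / R / (1 - t / R) ^ 2 with hk
  have hk0 : 0 ≤ k := by positivity
  rcases le_or_gt ‖g (t * e)‖ 1 with h1 | h1
  · have : 0 ≤ 8 * Real.pi / d * k := by positivity
    linarith
  obtain ⟨v, hv, hv1⟩ := hg.exists_norm_ray_eq_one he le_rfl ht0 htR (by simpa using hg0) h1
  have hvR : 0 < R - v := by linarith [hv.2]
  have hmain : ∀ a, 2 * Real.pi / d < a → ‖g (t * e)‖ - 1 ≤ 4 * a * k := fun a ha => by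
    obtain ⟨p, hp1, hp2⟩ : ∃ p ∈ ball (g (v * e)) a, p ∉ g '' ball 0 R := by
      by_contra! h
      exact absurd (hg.radius_le_of_ball_subset hf hd hv1 h) (not_le.2 ha)
    -- `A` maps the unit disk onto the disk about `v e` of radius `R - v`, which is internally
    -- tangent to the disk of radius `R`, and the parameter `x` below to `t e`.
    set A : ℂ → ℂ := fun x => (v + x * (R - v)) * e with hA
    have hAm : MapsTo A (ball 0 1) (ball 0 R) := fun x hx => by
      have hx1 : ‖x‖ < 1 := by simpa using hx
      rw [mem_ball_zero_iff, hA, norm_mul, he, mul_one]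
      calc _ ≤ ‖(v : ℂ)‖ + ‖x * (R - v)‖ := norm_add_le _ _
        _ = v + ‖x‖ * (R - v) := by
          rw [norm_mul, ← ofReal_sub, norm_real, norm_real, Real.norm_of_nonneg hv.1.le,
            Real.norm_of_nonneg hvR.le]
        _ < R := by nlinarith
    have hAinj : Function.Injective A := fun x y hxy => by
      have he0 : e ≠ 0 := norm_pos_iff.1 (by linarith)
      have hne : (R : ℂ) - v ≠ 0 := by
        rw [← ofReal_sub]; exact_mod_cast hvR.ne'
      exact mul_right_cancel₀ hne (add_left_cancel (mul_right_cancel₀ he0 hxy))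
    set x := (t - v) / (R - v) with hx
    have hx0 : 0 ≤ x := div_nonneg (by linarith [hv.2]) hvR.le
    have hxt : x ≤ t / R := by
      rw [hx, div_le_div_iff₀ hvR hR]; nlinarith [hv.1]
    have key := koebe_growth (F := g ∘ A) (p := p)
      (hg.differentiableOn.comp (by fun_prop) hAm) (hg.injOn.comp hAinj.injOn hAm)
      (fun z hz h => hp2 ⟨A z, hAm hz, h⟩) hx0 (hxt.trans_lt htR1)
    have hA0 : A 0 = v * e := by simp [hA]
    have hAx : A x = t * e := by
      simp only [hA]
      congr 1
      rw [← ofReal_sub, ← ofReal_mul, ← ofReal_add, hx, div_mul_cancel₀ _ hvR.ne']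
      congr 1; ring
    simp only [Function.comp_apply, hA0, hAx] at key
    have h2 : ‖g (v * e) - p‖ ≤ a := by
      rw [mem_ball, dist_eq_norm, norm_sub_rev] at hp1; exact hp1.le
    have h3 := norm_sub_norm_le (g (t * e)) (g (v * e))
    have h4 := koebe_function_mono hx0 hxt htR1
    have h5 : 0 ≤ x / (1 - x) ^ 2 := by positivity
    have h6 : 0 ≤ a := (norm_nonneg _).trans h2
    calc ‖g (t * e)‖ - 1 ≤ ‖g (t * e) - g (v * e)‖ := by linarith
      _ ≤ 4 * ‖g (v * e) - p‖ * (x / (1 - x) ^ 2) := key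
      _ ≤ 4 * a * k := by gcongr
  have hlim : Tendsto (fun a : ℝ => 4 * a * k) (𝓝[>] (2 * Real.pi / d))
      (𝓝 (4 * (2 * Real.pi / d) * k)) :=
    Tendsto.mono_left (Continuous.tendsto (by fun_prop) _) nhdsWithin_le_nhds
  have := ge_of_tendsto hlim (eventually_mem_nhdsWithin.mono fun a ha => hmain a ha)
  calc _ ≤ _ := this
    _ = _ := by ring

theorem koebe_function_strictMono {x y : ℝ} (hx : 0 < x) (hxy : x < y) (hy : y < 1) :
    x / (1 - x) ^ 2 < y / (1 - y) ^ 2 := by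
  have h1 : 0 < 1 - y := by linarith
  have h2 : (1 - y) ^ 2 ≤ (1 - x) ^ 2 := by gcongr
  exact div_lt_div₀ hxy h2 (hx.trans hxy).le (by positivity)

/-- With `A = 2 + κ/n` the ratio of the powers is `(1 + y/n)^n` for `y = (p - κ)/A ≥ 1.89`, and its
binomial terms up to degree two already exceed `4`. -/
theorem four_mul_pow_lt {n : ℕ} (hn : 5 ≤ n) {κ p : ℝ} (hκ0 : 0 ≤ κ) (hκ : κ ≤ 1.8)
    (hp : 6.28 ≤ p) : 4 * (2 + κ / n) ^ n < (2 + p / n) ^ n := by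
  have hn' : (5 : ℝ) ≤ n := by exact_mod_cast hn
  have hn0 : (0 : ℝ) < n := by linarith
  set A := 2 + κ / n with hA
  have hA0 : 0 < A := by positivity
  have hA1 : A ≤ 2.36 := by
    have : κ / n ≤ 1.8 / 5 := by gcongr
    rw [hA]; linarith
  set y := (p - κ) / A with hy
  have hy1 : 1.89 ≤ y := by
    rw [hy, le_div_iff₀ hA0]; linarith
  have e : 2 + p / n = A * (1 + y / n) := by
    rw [hy, hA]
    have : A ≠ 0 := hA0.ne'
    rw [hA] at this
    field_simp
    ring
  have hbin : ∀ (x : ℝ), 0 ≤ x → ∀ m : ℕ, 1 + m * x + m * (m - 1) / 2 * x ^ 2 ≤ (1 + x) ^ m := by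
    intro x hx m
    induction m with
    | zero => simp
    | succ m ih =>
      rw [pow_succ]
      have h1 := mul_le_mul_of_nonneg_right ih (show 0 ≤ 1 + x by linarith)
      refine le_trans ?_ h1
      push_cast
      have h2 : 0 ≤ (m : ℝ) * (m - 1) := by
        rcases Nat.eq_zero_or_pos m with h | h
        · simp [h]
        · have : (1 : ℝ) ≤ m := by exact_mod_cast h
          exact mul_nonneg (by linarith) (by linarith)
      have h3 : 0 ≤ (m : ℝ) * (m - 1) / 2 * x ^ 3 := by positivity
      nlinarith
  have h1 := hbin (y / n) (by positivity) n
  have h2 : 1 + n * (y / n) + n * (n - 1) / 2 * (y / n) ^ 2 = 1 + y + (1 - 1 / n) / 2 * y ^ 2 := by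
    field_simp
  have h3 : 1 / (n : ℝ) ≤ 1 / 5 := by gcongr
  have h4 : (1.89 : ℝ) ^ 2 ≤ y ^ 2 := by gcongr
  have h5 : 4 < (1 + y / n) ^ n := by
    rw [h2] at h1
    refine lt_of_lt_of_le ?_ h1
    nlinarith
  rw [e, mul_pow, mul_comm]
  exact mul_lt_mul_of_pos_left h5 (pow_pos hA0 n)

/-- Far away from the unit disk the branch on the disk of radius `R / 4` takes no values. -/
theorem IsBranchOn.quarter_le_norm (hf : MemPd d f) (hd : 2 ≤ d)
    (hg : IsBranchOn f g (ball 0 R)) (hg0 : ‖g 0‖ < 1) (hR : R ≤ 2 ^ d) {e : ℂ} (he : ‖e‖ = 1)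
    {t : ℝ} (ht0 : 0 < t) (htR : t < R) (hgt : 2 * Real.pi / d < ‖g (t * e)‖ - 1) :
    R / 4 ≤ t := by
  have hπ := Real.pi_gt_d2
  have hπ' := Real.pi_lt_d2
  have hR0 : 0 < R := ht0.trans htR
  have hd0 : 0 < d := by omega
  have hd' : (0 : ℝ) < d := by exact_mod_cast hd0
  have hz1 : 1 ≤ ‖g (t * e)‖ := by
    have : 0 ≤ 2 * Real.pi / d := by positivity
    linarith
  -- For `d ≤ 4` one has `(2π/d)^d ≥ 2^d/4 ≥ R/4`.
  rcases Nat.lt_or_ge d 5 with h5 | h5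
  · have h1 := hf.pow_le_norm_eval hz1
    rw [hg.eval_eq _ (ray_mem_ball he ht0.le htR), norm_mul, he, mul_one, norm_real,
      Real.norm_of_nonneg ht0.le] at h1
    have h2 : (2 * Real.pi / d) ^ d ≤ (‖g (t * e)‖ - 1) ^ d := by gcongr
    have h3 : (2 : ℝ) ^ d / 4 ≤ (2 * Real.pi / d) ^ d := by
      have hb : 6.28 / (d : ℝ) ≤ 2 * Real.pi / d := by gcongr; linarith
      refine le_trans ?_ (pow_le_pow_left₀ (by positivity) hb d)
      interval_cases d <;> norm_num
    linarith
  by_contra! hlt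
  -- The radius `R/16` leaves a factor of at most `4` in `t` up to `R/4`, and keeps `κ` below `1.8`.
  -- From a point of modulus in `[1, 1 + κ/d]` that factor cannot bring `1 + |g|` up to `2 + 2π/d`.
  set κ := 8 * Real.pi * (1 / 16 / (1 - 1 / 16) ^ 2) with hκ
  have hκ0 : 0 ≤ κ := by positivity
  have hκ1 : κ ≤ 1.8 := by rw [hκ]; norm_num; linarith
  have hstar : ∀ v, 0 ≤ v → v ≤ R / 16 → ‖g (v * e)‖ ≤ 1 + κ / d := fun v hv0 hv => by
    have h1 := hg.norm_ray_sub_one_le hf hd hg0 he hv0 (by linarith)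
    have h2 : v / R ≤ 1 / 16 := by rw [div_le_iff₀ hR0]; linarith
    have h3 := koebe_function_mono (by positivity) h2 (by norm_num)
    have h4 : 8 * Real.pi / d * (v / R / (1 - v / R) ^ 2) ≤ κ / d := by
      calc _ ≤ 8 * Real.pi / d * (1 / 16 / (1 - 1 / 16) ^ 2) := by gcongr
        _ = κ / d := by rw [hκ]; ring
    linarith
  have hst : R / 16 < t := by
    by_contra! h
    have h1 := hstar t ht0.le h
    have h2 : κ / d ≤ 2 * Real.pi / d := by gcongr; linarith
    linarith
  obtain ⟨v, hv0, hvt, hv1, hv2⟩ : ∃ v, R / 16 ≤ v ∧ v ≤ t ∧ 1 ≤ ‖g (v * e)‖ ∧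
      ‖g (v * e)‖ ≤ 1 + κ / d := by
    have h0 := hstar (R / 16) (by positivity) le_rfl
    rcases le_or_gt 1 ‖g ((R / 16 : ℝ) * e)‖ with h | h
    · exact ⟨R / 16, le_rfl, hst.le, h, h0⟩
    · obtain ⟨v, hv, hv1⟩ := hg.exists_norm_ray_eq_one he (by positivity) hst.le htR h
        (lt_of_le_of_ne hz1 fun h' => by
          rw [← h'] at hgt
          have : 0 ≤ 2 * Real.pi / d := by positivity
          linarith)
      refine ⟨v, hv.1.le, hv.2.le, hv1.ge, ?_⟩
      rw [hv1]
      have : 0 ≤ κ / d := by positivity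
      linarith
  have hvpos : 0 < v := by linarith
  have h1 := hg.norm_ray_pow_le hf hd0 he hvpos hvt htR hv1
  have h2 : t / v ≤ 4 := by rw [div_le_iff₀ hvpos]; linarith
  have h3 := four_mul_pow_lt h5 hκ0 hκ1 (show 6.28 ≤ 2 * Real.pi by linarith)
  have h4 : (2 + 2 * Real.pi / d) ^ d ≤ (1 + ‖g (t * e)‖) ^ d :=
    pow_le_pow_left₀ (by positivity) (by linarith) d
  have h5 : (1 + ‖g (v * e)‖) ^ d * (t / v) ≤ (2 + κ / d) ^ d * 4 :=
    mul_le_mul (pow_le_pow_left₀ (by positivity) (by linarith) d) h2 (by positivity)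
      (by positivity)
  linarith

end NewtonFlow

/-! ### Choice of the constant and conclusion -/

theorem proposition5p6 (d : ℕ) (hd : 2 ≤ d) (r : ℝ) (hr : 1 < r) :
    ∃ s : ℝ, 0 < s ∧ s < 1 ∧
      (1 + 2 * Real.pi / d < r → s = 1 / 4) ∧
      (∀ C : ℝ, r = 1 + C / d → C ≤ 2 * Real.pi →
        IsLeast {t : ℝ | 0 < t ∧ C = 8 * Real.pi * (t / (1 - t) ^ 2)} s) ∧
      (r = 1 + 1 / d → 1 / 28 < s) ∧
      ∀ (f : Polynomial ℂ) (ζ : ℂ), NewtonFlow.MemPd d f → f.eval ζ = 0 →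
        IsLeast (NewtonFlow.criticalModuli f ζ) (NewtonFlow.rho f ζ) ∧
        (∃ p : FormalMultilinearSeries ℂ ℂ ℂ, NewtonFlow.IsInverseBranchSeries f ζ p ∧
          p.radius = ENNReal.ofReal (NewtonFlow.rho f ζ)) ∧
        ∀ z ∈ NewtonFlow.basin f ζ, ‖z‖ = r → s * NewtonFlow.rho f ζ ≤ ‖f.eval z‖ := by
  have hd0 : 0 < d := by omega
  have hd' : (0 : ℝ) < d := by exact_mod_cast hd0
  have hπ := Real.pi_gt_d2
  have hπ' := Real.pi_lt_d2
  suffices H : ∃ s : ℝ, 0 < s ∧ s < 1 ∧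
      (1 + 2 * Real.pi / d < r → s = 1 / 4) ∧
      (∀ C : ℝ, r = 1 + C / d → C ≤ 2 * Real.pi →
        IsLeast {t : ℝ | 0 < t ∧ C = 8 * Real.pi * (t / (1 - t) ^ 2)} s) ∧
      (r = 1 + 1 / d → 1 / 28 < s) ∧
      ∀ (f : ℂ[X]) (g : ℂ → ℂ) (R t : ℝ) (e : ℂ), NewtonFlow.MemPd d f →
        NewtonFlow.IsBranchOn f g (ball 0 R) → ‖g 0‖ < 1 → R ≤ 2 ^ d → ‖e‖ = 1 → 0 < t → t < R →
        ‖g (t * e)‖ = r → s * R ≤ t by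
    obtain ⟨s, hs0, hs1, h1, h2, h3, hmain⟩ := H
    refine ⟨s, hs0, hs1, h1, h2, h3, fun f ζ hf hζ => ?_⟩
    obtain ⟨p, g, R, hR, hp, hpR, hleast, hg, hg0, hbasin⟩ := NewtonFlow.exists_branch
      (hf.exists_derivative_root hd) hζ (hf.derivative_ne_zero_of_root hζ)
    have hrho : NewtonFlow.rho f ζ = R := hleast.csInf_eq
    rw [hrho]
    refine ⟨hleast, ⟨p, hp, hpR⟩, fun z hz hzr => ?_⟩
    rcases le_or_gt R ‖f.eval z‖ with h | h
    · nlinarith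
    have hz0 : f.eval z ≠ 0 := hf.eval_ne_zero (by rw [hzr]; exact hr.le)
    have hn : 0 < ‖f.eval z‖ := norm_pos_iff.2 hz0
    -- `R` is the modulus of a critical value, and critical points lie in the unit disk.
    have hR2 : R ≤ 2 ^ d := by
      obtain ⟨c, ⟨hc, -⟩, hcR⟩ := hleast.1
      rw [← hcR]
      refine hf.norm_eval_le_two_pow ?_
      by_contra! hc1
      exact hf.derivative_ne_zero hd0 hc1.le hc
    refine hmain f g R ‖f.eval z‖ (f.eval z / ‖f.eval z‖) hf hg
      (hg0 ▸ hf.norm_root_lt hζ) hR2 ?_ hn h ?_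
    · rw [norm_div, norm_real, norm_norm, div_self hn.ne']
    · rw [mul_div_cancel₀ _ (by exact_mod_cast hn.ne'), hbasin z hz h, hzr]
  rcases lt_or_ge (1 + 2 * Real.pi / d) r with hlt | hle
  · have hlt' : 2 * Real.pi < d * (r - 1) := by
      rw [← div_lt_iff₀' hd']; linarith
    refine ⟨1 / 4, by norm_num, by norm_num, fun _ => rfl, fun C hC hC2 => ?_,
      fun _ => by norm_num, fun f g R t e hf hg hg0 hR he ht0 htR hgt => ?_⟩
    · rw [hC, add_sub_cancel_left, mul_div_cancel₀ _ hd'.ne'] at hlt'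
      linarith
    · have := hg.quarter_le_norm hf hd hg0 hR he ht0 htR (by rw [hgt]; linarith)
      linarith
  · set K := d * (r - 1) with hK
    have hK0 : 0 < K := mul_pos hd' (by linarith)
    have hK2 : K ≤ 2 * Real.pi := by
      rw [hK, ← le_div_iff₀' hd']; linarith
    have hCK : ∀ C : ℝ, r = 1 + C / d → C = K := fun C hC => by
      rw [hK, hC]; field_simp; ring
    -- At `1/2` the function has the value `16π`, well above `K ≤ 2π`. Its strict growth on `(0, 1)`
    -- makes `s` the smallest positive solution.
    obtain ⟨s, hs, hsK⟩ := intermediate_value_Ioo (show (0 : ℝ) ≤ 1 / 2 by norm_num)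
      (f := fun t : ℝ => 8 * Real.pi * (t / (1 - t) ^ 2))
      (by
        refine continuousOn_const.mul (continuousOn_id.div (by fun_prop) fun t ht => ?_)
        have : 0 < 1 - t := by linarith [ht.2]
        positivity)
      (show K ∈ Ioo _ _ from ⟨by simpa using hK0, by norm_num; linarith⟩)
    have hs1 : s < 1 := by linarith [hs.2]
    simp only at hsK
    refine ⟨s, hs.1, hs1, fun h => absurd h (not_lt.2 hle), fun C hC _ => ?_, fun h => ?_,
      fun f g R t e hf hg hg0 hR he ht0 htR hgt => ?_⟩
    · rw [hCK C hC, ← hsK]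
      refine ⟨⟨hs.1, rfl⟩, fun t ⟨ht0, ht⟩ => ?_⟩
      by_contra! hts
      have := NewtonFlow.koebe_function_strictMono ht0 hts hs1
      have h2 := mul_lt_mul_of_pos_left this (show 0 < 8 * Real.pi by positivity)
      linarith
    -- At `1/28` the function is `8π · 28/729 < 1`.
    · by_contra! hs28
      rw [← hCK 1 h] at hsK
      have h1 := NewtonFlow.koebe_function_mono hs.1.le hs28 (by norm_num)
      have h2 := mul_le_mul_of_nonneg_left h1 (show 0 ≤ 8 * Real.pi by positivity)
      rw [hsK] at h2
      norm_num at h2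
      linarith
    · have hR0 : 0 < R := ht0.trans htR
      have h1 := hg.norm_ray_sub_one_le hf hd hg0 he ht0.le htR
      rw [hgt, div_mul_eq_mul_div, le_div_iff₀' hd', ← hK, ← hsK] at h1
      by_contra! hts
      have h2 : t / R < s := by rwa [div_lt_iff₀ hR0]
      have h3 := NewtonFlow.koebe_function_strictMono (by positivity) h2 hs1
      have h4 := mul_lt_mul_of_pos_left h3 (show 0 < 8 * Real.pi by positivity)
      linarith
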